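/- Let $k=\mathbf F_q$ be a finite field and let $X$ be a variety over $k$, i.e. a reduced and separated scheme of finite type over $k$. For a $k$-scheme $S$ put $N(S)=|S(k)|$, and for $n\ge 1$ put $N_n=|X(\mathbf F_{q^n})|$. For $n\ge 0$ let $X^n$ be the $n$-fold fibre product of $X$ over $k$, with the symmetric group $\mathfrak S_n$ permuting the factors. A symmetric product $X^{(n)}$ is a quotient of $X^n$ by $\mathfrak S_n$ in the category of $k$-schemes, i.e. a $k$-scheme $X^{(n)}$ with an $\mathfrak S_n$-invariant affine $k$-morphism $\pi_n\colon X^n\to X^{(n)}$ such that $\mathcal O_{X^{(n)}}\to(\pi_{n*}\mathcal O_{X^n})^{\mathfrak S_n}$ is an isomorphism; it is unique up to unique isomorphism if it exists. (a) If every finite set of points of $X$ is contained in an affine open subset (for example, if $X$ is quasi-projective), then $X^{(n)}$ exists for every $n\ge 0$. (b) The numbers $N_n$ ($n\ge1$) are finite. Whenever the symmetric products $X^{(n)}$ exist for all $n\ge0$, the numbers $N(X^{(n)})$ are finite, and the series $\sum_{n\ge 0} N(X^{(n)})\,T^n$ equals the Hasse–Weil zeta function of $X$: $$\sum_{n\ge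 0} N(X^{(n)})\,T^n=\exp\Bigl(\sum_{n\ge 1}\frac{N_n}{n}\,T^n\Bigr)\quad\text{in } \mathbf Q[[T]].$$ -/

import Mathlib

open CategoryTheory CategoryTheory.Limits AlgebraicGeometry

universe u

namespace SymZeta

/-- A variety over the base scheme `S`: a reduced and separated scheme of finite type over `S`. -/
structure IsVariety {S : Scheme.{u}} (X : Over S) : Prop where
  reduced : IsReduced X.left
  separated : IsSeparated X.hom
  locallyOfFiniteType : LocallyOfFiniteType X.hom
  quasiCompact : QuasiCompact X.hom

/-- Every finite set of points of `X` lies in an affine open subscheme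
(this holds for instance if `X` is quasi-projective over a field). -/
def FiniteSetsInAffine (X : Scheme.{u}) : Prop :=
  ∀ s : Set X, s.Finite → ∃ U : X.Opens, IsAffineOpen U ∧ s ⊆ U

/-- The quotient of a scheme `P` by a finite group, given by the automorphisms `act g`
(all in the category of `S`-schemes): an invariant affine morphism `π : P ⟶ Y` such that
`𝒪_Y ⟶ π_* 𝒪_P` is injective with image the invariant sections. These conditions
determine `π` up to unique isomorphism. -/
structure IsQuotient {S : Scheme.{u}} {G : Type*} {P Y : Over S}
    (act : G → (P ⟶ P)) (π : P ⟶ Y) : Prop where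
  invariant : ∀ g, act g ≫ π = π
  affine : IsAffineHom π.left
  injective : ∀ U : Y.left.Opens, Function.Injective (π.left.app U)
  exists_of_invariant : ∀ (U : Y.left.Opens) (s : Γ(P.left, π.left ⁻¹ᵁ U)),
    (∀ (g : G) (h : π.left ⁻¹ᵁ U ≤ (act g).left ⁻¹ᵁ (π.left ⁻¹ᵁ U)),
      (act g).left.appLE (π.left ⁻¹ᵁ U) (π.left ⁻¹ᵁ U) h s = s) →
    ∃ t : Γ(Y.left, U), π.left.app U t = s

noncomputable section

/-- The `n`-fold cartesian product `X ×_S ⋯ ×_S X`. -/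
abbrev power {S : Scheme.{u}} (X : Over S) (n : ℕ) : Over S := ∏ᶜ fun _ : Fin n => X

/-- The permutation `σ` of the factors of the `n`-fold cartesian product. -/
def permute {S : Scheme.{u}} (X : Over S) (n : ℕ) (σ : Equiv.Perm (Fin n)) :
    power X n ⟶ power X n :=
  Pi.lift fun i => Pi.π (fun _ : Fin n => X) (σ i)

/-- `π : X ^ n ⟶ Y` exhibits `Y` as the `n`-fold symmetric product of `X`: the quotient of
the cartesian product by the symmetric group. -/
def IsSymmetricProduct {S : Scheme.{u}} (X : Over S) (n : ℕ) {Y : Over S}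
    (π : power X n ⟶ Y) : Prop :=
  IsQuotient (permute X n) π

/-- The set `X(K)` of `K`-rational points of a `k`-scheme `X`: the `k`-morphisms
`Spec K ⟶ X`. -/
abbrev Points {k : Type u} [Field k] (X : Over (Spec (CommRingCat.of k)))
    (K : Type u) [Field K] [Algebra k K] : Type u :=
  Over.mk (Spec.map (CommRingCat.ofHom (algebraMap k K))) ⟶ X

open Polynomial in
/-- For a finite field `k` with `q` elements and `n ≥ 1`, the field with `q ^ n` elements, as
an extension of `k`. -/
abbrev Ext (k : Type u) [Field k] (n : ℕ) : Type u :=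
  (X ^ (Nat.card k ^ n) - X : k[X]).SplittingField

/-- The Hasse-Weil zeta function `exp (∑_{n ≥ 1} |X(𝔽_{q^n})| T^n / n)` of a scheme over the
finite field `k` with `q` elements. -/
def hasseWeil {k : Type u} [Field k] (X : Over (Spec (CommRingCat.of k))) : PowerSeries ℚ :=
  (PowerSeries.exp ℚ).subst
    (PowerSeries.mk fun n : ℕ =>
      if n = 0 then (0 : ℚ) else (Nat.card (Points X (Ext k n)) : ℚ) / n)

end

end SymZeta

/-! Let K be an algebraic closure of k, F the q-power Frobenius of K and Z = X(K). Both sides become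
counts on Z with the injective self-map induced by F.

Geometry: a symmetric product is locally Spec of a ring B of invariants in a ring A. As A is
integral over B, every homomorphism B → K extends to A (`exists_comp_eq_of_isIntegral`), and two
homomorphisms from A to a domain that agree on B are conjugate under the group
(`exists_eq_comp_smul`). So the K-points of the n-th symmetric product are the multisets of n points
of Z. By descent (`pointsMap_eq_iff_mem_range`) its k-points are the F-invariant multisets, and
X(𝔽_{q^n}) is the fixed set of F^n.

Combinatorics: let a_n be the number of invariant multisets of size n. Counting those with a marked
element in two ways gives n a_n = ∑ N_j a_{n-j}, the sum running over 1 ≤ j ≤ n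
(`card_invMultisets_recurrence`). For A = ∑ a_n T^n and g = ∑ N_n T^n / n this reads A' = A g', and
a_0 = 1 then forces A = exp g (`eq_exp_subst`).

Existence: if an affine open U contains all coordinates of a point of X^n, then U^n is an invariant
affine neighbourhood of it. The spectra of the invariant sections over such opens form a locally
directed diagram of open immersions, and its colimit is the quotient (`exists_isQuotient`). -/

namespace SymZeta

/-! ### Exponentials of power series via the logarithmic derivative -/

section PowerSeriesExp

open PowerSeries

lemma constantCoeff_exp_subst {g : PowerSeries ℚ} (hg : constantCoeff g = 0) :
    constantCoeff ((PowerSeries.exp ℚ).subst g) = 1 := by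
  have h := PowerSeries.constantCoeff_subst (HasSubst.of_constantCoeff_zero hg)
    (PowerSeries.exp ℚ)
  refine h.trans ?_
  rw [finsum_eq_single _ 0]
  · simp
  · intro d hd
    have : MvPowerSeries.constantCoeff (g ^ d) = (0 : ℚ) := by
      rw [map_pow]
      erw [hg]
      exact zero_pow hd
    rw [this, smul_zero]

/-- A power series `A` with constant term `1` such that `dA = A dg` is `exp g`. -/
lemma eq_exp_subst {A g : PowerSeries ℚ} (hg : constantCoeff g = 0) (hA : constantCoeff A = 1)
    (h : PowerSeries.derivative ℚ A = A * PowerSeries.derivative ℚ g) :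
    A = (PowerSeries.exp ℚ).subst g := by
  set E := (PowerSeries.exp ℚ).subst g with hE
  have hE0 : constantCoeff E = 1 := constantCoeff_exp_subst hg
  have hE' : PowerSeries.derivative ℚ E = E * PowerSeries.derivative ℚ g := by
    rw [hE, PowerSeries.derivative_subst (HasSubst.of_constantCoeff_zero hg),
      PowerSeries.derivative_exp]
  have hinv : E * E⁻¹ = 1 := PowerSeries.mul_inv_cancel _ (by rw [hE0]; exact one_ne_zero)
  -- `E` solves the same linear equation as `A`, so `A / E` has derivative zero and constant term
  -- `1`.
  have key : A * E⁻¹ = 1 := by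
    apply PowerSeries.derivative.ext
    · rw [Derivation.leibniz, PowerSeries.derivative_inv', h, hE', derivative_one]
      simp only [smul_eq_mul]
      linear_combination (-A * E⁻¹ * PowerSeries.derivative ℚ g) * hinv
    · rw [map_mul, hA, PowerSeries.constantCoeff_inv, hE0]
      simp
  calc A = A * E⁻¹ * E := by rw [mul_assoc, mul_comm E⁻¹, hinv, mul_one]
    _ = E := by rw [key, one_mul]

/-- The derivative of the exponent is `∑ N (i + 1) T ^ i`, so the recurrence at `n + 1` is exactly
the coefficient of `T ^ n` in `A' = A g'`. -/
lemma mk_eq_exp_subst_of_recurrence {a N : ℕ → ℕ} (h0 : a 0 = 1)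
    (h : ∀ n, n * a n = ∑ j ∈ Finset.Icc 1 n, N j * a (n - j)) :
    PowerSeries.mk (fun n => (a n : ℚ)) = (PowerSeries.exp ℚ).subst
      (PowerSeries.mk fun n : ℕ => if n = 0 then (0 : ℚ) else (N n : ℚ) / n) := by
  apply eq_exp_subst
  · simp [← PowerSeries.coeff_zero_eq_constantCoeff_apply]
  · simp [← PowerSeries.coeff_zero_eq_constantCoeff_apply, h0]
  · ext n
    rw [PowerSeries.coeff_derivative, PowerSeries.coeff_mk, mul_comm (PowerSeries.mk _),
      PowerSeries.coeff_mul, Finset.Nat.sum_antidiagonal_eq_sum_range_succ_mk]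
    have h1 := congrArg (Nat.cast : ℕ → ℚ) (h (n + 1))
    push_cast at h1
    have h2 : Finset.Icc 1 (n + 1) = Finset.Ico (0 + 1) (n + 1 + 1) := by ext; simp
    rw [mul_comm, h1, h2, ← Finset.sum_Ico_add', ← Finset.range_eq_Ico]
    refine Finset.sum_congr rfl fun i _ => ?_
    rw [PowerSeries.coeff_derivative, PowerSeries.coeff_mk, PowerSeries.coeff_mk,
      if_neg (Nat.succ_ne_zero i), Nat.add_sub_add_right]
    have : ((i : ℚ) + 1) ≠ 0 := by positivity
    push_cast
    field_simp

end PowerSeriesExp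

/-! ### Counting the finite multisets invariant under an injective map -/

section InvariantMultisets

variable {Z : Type*} (F : Z → Z)

/-- The multisets of cardinality `n` invariant under `F`. -/
def invMultisets (n : ℕ) : Set (Multiset Z) := {m | m.card = n ∧ m.map F = m}

/-- The orbit of a periodic point, as a multiset. -/
noncomputable def orbitMultiset (z : Z) : Multiset Z :=
  (Multiset.range (Function.minimalPeriod F z)).map fun i => F^[i] z

variable {F}

lemma iterate_mem {m : Multiset Z} (hm : m.map F = m) {z : Z} (hz : z ∈ m) (i : ℕ) :
    F^[i] z ∈ m := by
  induction i with
  | zero => exact hz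
  | succ i ih =>
    rw [Function.iterate_succ_apply', ← hm]
    exact Multiset.mem_map_of_mem F ih

/-- Pigeonhole: the iterates of `z` stay in `m`, so two of the first `m.card + 1` coincide, and
injectivity cancels the common iterate. -/
lemma exists_periodic_of_mem (hF : Function.Injective F) {m : Multiset Z} (hm : m.map F = m)
    {z : Z} (hz : z ∈ m) : ∃ j ∈ Finset.Icc 1 m.card, F^[j] z = z := by
  classical
  have hmaps : ∀ i ∈ Finset.range (m.card + 1), F^[i] z ∈ m.toFinset := fun i _ =>
    Multiset.mem_toFinset.2 (iterate_mem hm hz i)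
  have hcard : m.toFinset.card < (Finset.range (m.card + 1)).card := by
    rw [Finset.card_range]
    exact Nat.lt_succ_of_le (Multiset.toFinset_card_le m)
  obtain ⟨i, hi, j, hj, hij, h⟩ := Finset.exists_ne_map_eq_of_card_lt_of_maps_to hcard hmaps
  have main : ∀ i j : ℕ, i < j → j ≤ m.card → F^[i] z = F^[j] z →
      ∃ j ∈ Finset.Icc 1 m.card, F^[j] z = z := by
    intro i j hij hj h
    refine ⟨j - i, Finset.mem_Icc.2 ⟨by omega, by omega⟩, ?_⟩
    apply hF.iterate i
    rw [← Function.iterate_add_apply, Nat.add_sub_cancel' hij.le, h]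
  simp only [Finset.mem_range] at hi hj
  rcases lt_or_gt_of_ne hij with h1 | h1
  · exact main i j h1 (by omega) h
  · exact main j i h1 (by omega) h.symm

/-- All elements have a period at most `n`, hence lie in a fixed finite set, and multiplicities are
at most `n`; so everything lies below one multiset. -/
lemma finite_invMultisets (hF : Function.Injective F)
    (hfix : ∀ j, 1 ≤ j → {z | F^[j] z = z}.Finite) (n : ℕ) : (invMultisets F n).Finite := by
  classical
  have hS : (⋃ j ∈ Finset.Icc 1 n, {z | F^[j] z = z}).Finite :=
    Set.Finite.biUnion (Finset.finite_toSet _) fun j hj => hfix j (Finset.mem_Icc.1 hj).1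
  refine (Set.finite_Iic (n • hS.toFinset.val)).subset ?_
  rintro m ⟨hc, hm⟩
  rw [Set.mem_Iic, Multiset.le_iff_count]
  intro z
  by_cases hz : z ∈ m
  · have hzS : z ∈ hS.toFinset := by
      obtain ⟨j, hj, h⟩ := exists_periodic_of_mem hF hm hz
      rw [hc] at hj
      simp only [Set.Finite.mem_toFinset, Set.mem_iUnion]
      exact ⟨j, hj, h⟩
    rw [Multiset.count_nsmul, Multiset.count_eq_one_of_mem hS.toFinset.nodup hzS, mul_one, ← hc]
    exact Multiset.count_le_card z m
  · rw [Multiset.count_eq_zero_of_notMem hz]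
    exact Nat.zero_le _

lemma card_orbitMultiset (z : Z) : (orbitMultiset F z).card = Function.minimalPeriod F z := by
  simp [orbitMultiset]

lemma nodup_orbitMultiset (z : Z) : (orbitMultiset F z).Nodup := by
  refine Multiset.Nodup.map_on ?_ (Multiset.nodup_range _)
  intro i hi j hj h
  exact Function.iterate_injOn_Iio_minimalPeriod (Multiset.mem_range.1 hi)
    (Multiset.mem_range.1 hj) h

lemma map_orbitMultiset (z : Z) : (orbitMultiset F z).map F = orbitMultiset F z := by
  unfold orbitMultiset
  rw [Multiset.map_map]
  -- A non-periodic point has minimal period `0` and an empty orbit multiset. Otherwise `F` shifts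
  -- the indices by one and the last iterate wraps around to `z`.
  rcases hd : Function.minimalPeriod F z with _ | d
  · simp
  · have h1 : (Multiset.range (d + 1)).map (F ∘ fun i => F^[i] z)
        = (Multiset.range (d + 1)).map fun i => F^[i + 1] z :=
      Multiset.map_congr rfl fun i _ => (Function.iterate_succ_apply' F i z).symm
    rw [h1]
    conv_lhs => rw [Multiset.range_succ, Multiset.map_cons, ← hd,
      Function.iterate_minimalPeriod]
    have h2 : ∀ n : ℕ, Multiset.range (n + 1) = 0 ::ₘ (Multiset.range n).map Nat.succ := by
      intro n
      rw [Multiset.range, List.range_succ_eq_map]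
      rfl
    rw [h2, Multiset.map_cons, Multiset.map_map]
    rfl

lemma self_mem_orbitMultiset {z : Z} (hz : 0 < Function.minimalPeriod F z) :
    z ∈ orbitMultiset F z :=
  Multiset.mem_map.2 ⟨0, Multiset.mem_range.2 hz, rfl⟩

lemma count_iterate [DecidableEq Z] (hF : Function.Injective F) {m : Multiset Z}
    (hm : m.map F = m) (z : Z) (i : ℕ) : m.count (F^[i] z) = m.count z := by
  induction i with
  | zero => rfl
  | succ i ih =>
    rw [Function.iterate_succ_apply', ← ih]
    conv_lhs => rw [← hm]
    exact Multiset.count_map_eq_count' F m hF _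

lemma nsmul_orbitMultiset_le [DecidableEq Z] (hF : Function.Injective F) {m : Multiset Z}
    (hm : m.map F = m) {z : Z} {i : ℕ} (hi : i ≤ m.count z) : i • orbitMultiset F z ≤ m := by
  rw [Multiset.le_iff_count]
  intro w
  rw [Multiset.count_nsmul]
  by_cases hw : w ∈ orbitMultiset F z
  · rw [Multiset.count_eq_one_of_mem (nodup_orbitMultiset z) hw, mul_one]
    obtain ⟨j, -, rfl⟩ := Multiset.mem_map.1 hw
    rwa [count_iterate hF hm]
  · rw [Multiset.count_eq_zero_of_notMem hw]
    exact Nat.zero_le _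

lemma map_sub_of_le [DecidableEq Z] (s t : Multiset Z)
    (h : t ≤ s) : (s - t).map F = s.map F - t.map F := by
  obtain ⟨u, rfl⟩ := Multiset.le_iff_exists_add.1 h
  rw [Multiset.map_add, add_tsub_cancel_left, add_tsub_cancel_left]

/-- The recurrence relating the numbers of invariant multisets and of periodic points: both
sides count the invariant multisets with a distinguished element. -/
lemma card_invMultisets_recurrence (hF : Function.Injective F)
    (hfix : ∀ j, 1 ≤ j → {z | F^[j] z = z}.Finite) (n : ℕ) :
    n * (invMultisets F n).ncard =
      ∑ j ∈ Finset.Icc 1 n, {z | F^[j] z = z}.ncard * (invMultisets F (n - j)).ncard := by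
  classical
  have hI := finite_invMultisets hF hfix
  -- Finiteness is known only for `1 ≤ j`; the value at `j = 0` is a dummy.
  have hfix' : ∀ j, ∃ s : Finset Z, 1 ≤ j → ∀ z, z ∈ s ↔ F^[j] z = z := by
    intro j
    by_cases hj : 1 ≤ j
    · exact ⟨(hfix j hj).toFinset, fun _ z => by simp⟩
    · exact ⟨∅, fun h => absurd h hj⟩
  choose S hS using hfix'
  have hL : ((hI n).toFinset.sigma fun m => m.toEnumFinset).card
      = n * (invMultisets F n).ncard := by
    rw [Finset.card_sigma, Set.ncard_eq_toFinset_card _ (hI n), mul_comm, ← smul_eq_mul,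
      ← Finset.sum_const]
    refine Finset.sum_congr rfl fun m hm => ?_
    rw [Multiset.card_toEnumFinset]
    exact ((Set.Finite.mem_toFinset _).1 hm).1
  have hR : ((Finset.Icc 1 n).sigma fun j => S j ×ˢ (hI (n - j)).toFinset).card
      = ∑ j ∈ Finset.Icc 1 n, {z | F^[j] z = z}.ncard * (invMultisets F (n - j)).ncard := by
    rw [Finset.card_sigma]
    refine Finset.sum_congr rfl fun j hj => ?_
    rw [Finset.card_product, Set.ncard_eq_toFinset_card _ (hI (n - j)),
      ← Set.ncard_coe_finset (S j)]
    congr 2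
    ext z
    simpa using hS j (Finset.mem_Icc.1 hj).1 z
  rw [← hL, ← hR]
  -- Let `d` be the minimal period of `z`. The `i`-th copy of `z` in `m`, counted from `0`, goes to
  -- `j = (i + 1) d` and to `m` with `i + 1` copies of the orbit removed. Conversely `F^[j] z = z`
  -- forces `d ∣ j`; adding `j / d` copies of the orbit and marking copy `j / d - 1` inverts this.
  refine Finset.card_bij'
    (fun p _ => ⟨(p.2.2 + 1) * Function.minimalPeriod F p.2.1,
      (p.2.1, p.1 - (p.2.2 + 1) • orbitMultiset F p.2.1)⟩)
    (fun p _ => ⟨p.2.2 + (p.1 / Function.minimalPeriod F p.2.1) • orbitMultiset F p.2.1,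
      (p.2.1, p.1 / Function.minimalPeriod F p.2.1 - 1)⟩) ?_ ?_ ?_ ?_
  · rintro ⟨m, z, i⟩ hp
    simp only [Finset.mem_sigma, Set.Finite.mem_toFinset, Multiset.mem_toEnumFinset] at hp
    obtain ⟨⟨hc, hm⟩, hi⟩ := hp
    have hz : z ∈ m := Multiset.count_pos.1 (by omega)
    obtain ⟨j, hj, hjz⟩ := exists_periodic_of_mem hF hm hz
    have hd : 0 < Function.minimalPeriod F z :=
      Function.IsPeriodicPt.minimalPeriod_pos (Finset.mem_Icc.1 hj).1 hjz
    have hle := nsmul_orbitMultiset_le hF hm (z := z) (i := i + 1) hi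
    have hcle := Multiset.card_le_card hle
    rw [Multiset.card_nsmul, card_orbitMultiset, hc] at hcle
    have h1 : 1 ≤ (i + 1) * Function.minimalPeriod F z := Nat.mul_pos (Nat.succ_pos i) hd
    simp only [Finset.mem_sigma, Finset.mem_Icc, Finset.mem_product, Set.Finite.mem_toFinset]
    refine ⟨⟨h1, hcle⟩, (hS _ h1 _).2 ?_, ?_, ?_⟩
    · exact (Function.isPeriodicPt_minimalPeriod F z).const_mul (i + 1)
    · rw [Multiset.card_sub hle, hc, Multiset.card_nsmul, card_orbitMultiset]
    · rw [map_sub_of_le _ _ hle, hm, Multiset.map_nsmul, map_orbitMultiset]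
  · rintro ⟨j, z, m⟩ hp
    simp only [Finset.mem_sigma, Finset.mem_Icc, Finset.mem_product,
      Set.Finite.mem_toFinset] at hp
    obtain ⟨⟨h1, hjn⟩, hz, hc, hm⟩ := hp
    have hz' := (hS j h1 z).1 hz
    have hd := Function.IsPeriodicPt.minimalPeriod_pos h1 hz'
    have hdj := Function.IsPeriodicPt.minimalPeriod_dvd hz'
    have hpos : 0 < j / Function.minimalPeriod F z := Nat.div_pos (Nat.le_of_dvd h1 hdj) hd
    simp only [Finset.mem_sigma, Set.Finite.mem_toFinset, Multiset.mem_toEnumFinset]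
    refine ⟨⟨?_, ?_⟩, ?_⟩
    · rw [Multiset.card_add, hc, Multiset.card_nsmul, card_orbitMultiset,
        Nat.div_mul_cancel hdj]
      omega
    · rw [Multiset.map_add, hm, Multiset.map_nsmul, map_orbitMultiset]
    · rw [Multiset.count_add, Multiset.count_nsmul, Multiset.count_eq_one_of_mem
        (nodup_orbitMultiset z) (self_mem_orbitMultiset hd)]
      omega
  · rintro ⟨m, z, i⟩ hp
    simp only [Finset.mem_sigma, Set.Finite.mem_toFinset, Multiset.mem_toEnumFinset] at hp
    obtain ⟨⟨hc, hm⟩, hi⟩ := hp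
    have hz : z ∈ m := Multiset.count_pos.1 (by omega)
    obtain ⟨j, hj, hjz⟩ := exists_periodic_of_mem hF hm hz
    have hd : 0 < Function.minimalPeriod F z :=
      Function.IsPeriodicPt.minimalPeriod_pos (Finset.mem_Icc.1 hj).1 hjz
    have hle := nsmul_orbitMultiset_le hF hm (z := z) (i := i + 1) hi
    simp only [Nat.mul_div_cancel _ hd, Nat.add_sub_cancel]
    rw [tsub_add_cancel_of_le hle]
  · rintro ⟨j, z, m⟩ hp
    simp only [Finset.mem_sigma, Finset.mem_Icc, Finset.mem_product,
      Set.Finite.mem_toFinset] at hp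
    obtain ⟨⟨h1, hjn⟩, hz, hc, hm⟩ := hp
    have hz' := (hS j h1 z).1 hz
    have hd := Function.IsPeriodicPt.minimalPeriod_pos h1 hz'
    have hdj := Function.IsPeriodicPt.minimalPeriod_dvd hz'
    have hpos : 0 < j / Function.minimalPeriod F z := Nat.div_pos (Nat.le_of_dvd h1 hdj) hd
    simp only [Nat.sub_add_cancel (Nat.succ_le_of_lt hpos), Nat.div_mul_cancel hdj,
      add_tsub_cancel_right]

lemma ncard_invMultisets_zero : (invMultisets F 0).ncard = 1 := by
  rw [Set.ncard_eq_one]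
  refine ⟨0, ?_⟩
  ext m
  simp only [invMultisets, Set.mem_ofPred_eq, Set.mem_singleton_iff, Multiset.card_eq_zero]
  exact ⟨fun h => h.1, fun h => ⟨h, by rw [h, Multiset.map_zero]⟩⟩

end InvariantMultisets

/-! ### Rings of invariants of a finite group -/

section Invariants

variable {G : Type*} [Group G] {A B : Type*} [CommRing A] [CommRing B]

/-- The ring homomorphism `i : B →+* A` identifies `B` with the ring of invariants of the action
`σ` of `G` on `A`. -/
structure IsInvariants (σ : G →* (A →+* A)) (i : B →+* A) : Prop where
  injective : Function.Injective i
  map_apply : ∀ g b, σ g (i b) = i b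
  exists_eq : ∀ a, (∀ g, σ g a = a) → ∃ b, i b = a

variable {σ : G →* (A →+* A)} {i : B →+* A}

lemma IsInvariants.isIntegral [Finite G] (h : IsInvariants σ i) : i.IsIntegral := by
  let := i.toAlgebra
  let : MulSemiringAction G A := MulSemiringAction.compHom A σ
  have : Algebra.IsInvariant B A G := ⟨fun a ha => h.exists_eq a ha⟩
  exact (Algebra.IsInvariant.isIntegral B A G).isIntegral

lemma IsInvariants.comap_surjective [Finite G] (h : IsInvariants σ i) :
    Function.Surjective (PrimeSpectrum.comap i) :=
  h.isIntegral.comap_surjective h.injective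

lemma IsInvariants.exists_comap_eq [Finite G] (h : IsInvariants σ i) {p q : PrimeSpectrum A}
    (hpq : PrimeSpectrum.comap i p = PrimeSpectrum.comap i q) :
    ∃ g, q = PrimeSpectrum.comap (σ g) p := by
  let := i.toAlgebra
  let : MulSemiringAction G A := MulSemiringAction.compHom A σ
  have : Algebra.IsInvariant B A G := ⟨fun a ha => h.exists_eq a ha⟩
  have : SMulCommClass G B A := ⟨fun g b a => by
    change σ g (i b * a) = i b * σ g a
    rw [map_mul, h.map_apply]⟩
  obtain ⟨g, hg⟩ := Algebra.IsInvariant.exists_smul_of_under_eq B A G p.asIdeal q.asIdeal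
    (congrArg PrimeSpectrum.asIdeal hpq)
  refine ⟨g⁻¹, ?_⟩
  ext a
  rw [hg, Ideal.mem_pointwise_smul_iff_inv_smul_mem]
  rfl

/-- The product of `Y - g • p` over the group has invariant coefficients. Working over `A[X]` lets
one element `p` record a witness for every `g`. -/
lemma map_charpoly_eq [Fintype G] [MulSemiringAction G A] {K : Type*} [CommRing K]
    {φ ψ : A →+* K} (h : ∀ a : A, (∀ g : G, g • a = a) → φ a = ψ a) (p : Polynomial A) :
    (MulSemiringAction.charpoly G p).map (Polynomial.mapRingHom φ) =
      (MulSemiringAction.charpoly G p).map (Polynomial.mapRingHom ψ) := by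
  ext n m
  simp only [Polynomial.coeff_map, Polynomial.coe_mapRingHom]
  refine h _ fun g => ?_
  rw [← Polynomial.coeff_smul, MulSemiringAction.smul_coeff_charpoly]

/-- Two homomorphisms to a domain which agree on the invariants are conjugate. -/
lemma exists_eq_comp_smul [Finite G] [MulSemiringAction G A] {K : Type*} [CommRing K] [IsDomain K]
    {φ ψ : A →+* K} (h : ∀ a : A, (∀ g : G, g • a = a) → φ a = ψ a) :
    ∃ g : G, ∀ a, ψ a = φ (g • a) := by
  cases nonempty_fintype G
  by_contra! hne
  choose a ha using hne
  let e := Fintype.equivFin G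
  -- All the counterexamples `a g` are packed into one polynomial. Its image under `ψ` is a root of
  -- the product of `Y - φ (g • p)`; as `K[X]` is a domain, `ψ p = φ (g • p)` for some `g`, and the
  -- coefficient at `e g` contradicts the choice of `a g`.
  let p : Polynomial A := ∑ g : G, Polynomial.monomial (e g : ℕ) (a g)
  have hp : ∀ g, p.coeff (e g) = a g := by
    intro g
    simp only [p, Polynomial.finsetSum_coeff, Polynomial.coeff_monomial]
    rw [Finset.sum_eq_single g]
    · simp
    · intro b _ hb
      rw [if_neg]
      intro hbg
      exact hb (e.injective (Fin.ext hbg))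
    · simp
  have h0 : ((MulSemiringAction.charpoly G p).map (Polynomial.mapRingHom φ)).eval
      (Polynomial.mapRingHom ψ p) = 0 := by
    rw [map_charpoly_eq h, Polynomial.eval_map, Polynomial.eval₂_hom,
      MulSemiringAction.eval_charpoly, map_zero]
  rw [MulSemiringAction.charpoly_eq, Polynomial.map_prod, Polynomial.eval_prod,
    Finset.prod_eq_zero_iff] at h0
  obtain ⟨g, -, hg⟩ := h0
  rw [Polynomial.map_sub, Polynomial.map_X, Polynomial.map_C, Polynomial.eval_sub,
    Polynomial.eval_X, Polynomial.eval_C, sub_eq_zero] at hg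
  have := congrArg (fun q => Polynomial.coeff q (e g)) hg
  simp only [Polynomial.coe_mapRingHom, Polynomial.coeff_map, Polynomial.coeff_smul, hp] at this
  exact ha g this

lemma IsInvariants.exists_eq_comp [Finite G] (h : IsInvariants σ i) {K : Type*} [CommRing K]
    [IsDomain K] {φ ψ : A →+* K} (hφψ : φ.comp i = ψ.comp i) : ∃ g, ψ = φ.comp (σ g) := by
  let : MulSemiringAction G A := MulSemiringAction.compHom A σ
  obtain ⟨g, hg⟩ := exists_eq_comp_smul (G := G) (φ := φ) (ψ := ψ) fun a ha => by
    obtain ⟨b, rfl⟩ := h.exists_eq a ha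
    exact RingHom.congr_fun hφψ b
  exact ⟨g, RingHom.ext hg⟩

/-- Homomorphisms to an algebraically closed field extend along integral extensions. -/
lemma exists_comp_eq_of_isIntegral (hi : i.IsIntegral) (hinj : Function.Injective i)
    {K : Type*} [Field K] [IsAlgClosed K] (β : B →+* K) : ∃ φ : A →+* K, φ.comp i = β := by
  let := i.toAlgebra
  have : Algebra.IsIntegral B A := ⟨hi⟩
  have : (RingHom.ker β).IsPrime := RingHom.ker_isPrime β
  -- Lying over: `A ⧸ Q` is then an integral extension of the domain `B ⧸ ker β`, which embeds in
  -- `K`.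
  obtain ⟨Q, -, hQ, hQB⟩ := Ideal.exists_ideal_over_prime_of_isIntegral (RingHom.ker β)
    (⊥ : Ideal A) (by
      intro b hb
      have : i b = 0 := hb
      rw [(injective_iff_map_eq_zero i).1 hinj b this]
      exact Ideal.zero_mem _)
  have : Q.LiesOver (RingHom.ker β) := ⟨hQB.symm⟩
  let : Algebra (B ⧸ RingHom.ker β) K := (RingHom.kerLift β).toAlgebra
  have : Module.IsTorsionFree (B ⧸ RingHom.ker β) K :=
    Module.isTorsionFree_iff_algebraMap_injective.2 (RingHom.kerLift_injective β)
  have : Module.IsTorsionFree (B ⧸ RingHom.ker β) (A ⧸ Q) :=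
    Module.isTorsionFree_iff_algebraMap_injective.2
      (FaithfulSMul.algebraMap_injective _ _)
  let φ : (A ⧸ Q) →ₐ[B ⧸ RingHom.ker β] K := IsAlgClosed.lift
  refine ⟨φ.toRingHom.comp (Ideal.Quotient.mk Q), ?_⟩
  ext b
  exact φ.commutes (Ideal.Quotient.mk _ b)

/-- Invariants commute with localization at an invariant element. -/
lemma IsInvariants.localization_lift [Finite G] {A' B' : Type*} [CommRing A'] [CommRing B']
    {σ' : G →* (A' →+* A')} {i' : B' →+* A'} (h : IsInvariants σ i) (h' : IsInvariants σ' i')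
    {r : A →+* A'} {s : B →+* B'} (hrs : r.comp i = i'.comp s)
    (hr : ∀ g, r.comp (σ g) = (σ' g).comp r) (f : B)
    (hinj : ∀ a, r a = 0 → ∃ n : ℕ, i f ^ n * a = 0)
    (hsurj : ∀ a', ∃ (n : ℕ) (a : A), r a = r (i f) ^ n * a') :
    (∀ b, s b = 0 → ∃ n : ℕ, f ^ n * b = 0) ∧
      ∀ b', ∃ (n : ℕ) (b : B), s b = s f ^ n * b' := by
  have hrs' : ∀ b, r (i b) = i' (s b) := fun b => RingHom.congr_fun hrs b
  refine ⟨fun b hb => ?_, fun b' => ?_⟩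
  · obtain ⟨n, hn⟩ := hinj (i b) (by rw [hrs', hb, map_zero])
    exact ⟨n, h.injective (by rw [map_mul, map_pow, hn, map_zero])⟩
  · classical
    cases nonempty_fintype G
    obtain ⟨n, a, ha⟩ := hsurj (i' b')
    have hg : ∀ g, ∃ n : ℕ, i f ^ n * (σ g a - a) = 0 := by
      intro g
      apply hinj
      have h1 : r (σ g a) = σ' g (r a) := RingHom.congr_fun (hr g) a
      rw [map_sub, h1, ha, map_mul, map_pow, hrs', h'.map_apply, h'.map_apply, sub_self]
    choose N hN using hg
    -- By finiteness of the group, one power of `f` kills all the differences `σ g a - a` at once.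
    obtain ⟨b, hb⟩ := h.exists_eq (i f ^ (∑ g, N g) * a) (by
      intro g
      rw [map_mul, map_pow, h.map_apply, ← sub_eq_zero, ← mul_sub]
      rw [← Finset.sum_erase_add _ _ (Finset.mem_univ g), pow_add, mul_assoc, hN, mul_zero])
    refine ⟨(∑ g, N g) + n, b, h'.injective ?_⟩
    rw [← hrs', hb, map_mul, map_pow, ha, map_mul, map_pow, ← hrs', ← mul_assoc, ← pow_add]

end Invariants

/-! ### Group actions on schemes and points with values in a field -/

section Action

variable {P : Scheme.{u}} {G : Type*} [Group G]

/-- The endomorphisms `ρ g` of `P` constitute a (right) action of `G` on `P`. -/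
structure IsAction (ρ : G → (P ⟶ P)) : Prop where
  map_one : ρ 1 = 𝟙 P
  map_mul : ∀ g h, ρ (g * h) = ρ g ≫ ρ h

variable {ρ : G → (P ⟶ P)}

/-- The action of `G` on the sections over an invariant open subset. -/
def sectionAction (hρ : IsAction ρ) (W : P.Opens) (hW : ∀ g, W ≤ ρ g ⁻¹ᵁ W) :
    G →* (Γ(P, W) →+* Γ(P, W)) where
  toFun g := ((ρ g).appLE W W (hW g)).hom
  map_one' := by
    have h : ∀ (f : P ⟶ P) (hf : W ≤ f ⁻¹ᵁ W), f = 𝟙 P → f.appLE W W hf = 𝟙 _ := by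
      rintro f hf rfl
      rw [Scheme.Hom.appLE, Scheme.Hom.id_app]
      exact (Category.id_comp _).trans (P.presheaf.map_id _)
    rw [h _ _ hρ.map_one]
    rfl
  map_mul' g h := by
    have key : ∀ (f : P ⟶ P) (hf : W ≤ f ⁻¹ᵁ W), f = ρ g ≫ ρ h →
        f.appLE W W hf = (ρ h).appLE W W (hW h) ≫ (ρ g).appLE W W (hW g) := by
      rintro f hf rfl
      rw [Scheme.Hom.appLE_comp_appLE]
    rw [key _ _ (hρ.map_mul g h)]
    rfl

end Action

section AffinePoints

variable {P : Scheme.{u}}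

lemma exists_eq_specMap_fromSpec {W : P.Opens} (hW : IsAffineOpen W) {R : CommRingCat.{u}}
    (p : Spec R ⟶ P) (hp : ∀ x, p x ∈ W) : ∃ φ : Γ(P, W) ⟶ R, p = Spec.map φ ≫ hW.fromSpec := by
  have h : Set.range p ⊆ Set.range hW.fromSpec := by
    rw [hW.range_fromSpec]
    rintro _ ⟨x, rfl⟩
    exact hp x
  refine ⟨Spec.preimage (IsOpenImmersion.lift hW.fromSpec p h), ?_⟩
  rw [Spec.map_preimage, IsOpenImmersion.lift_fac]

lemma specMap_fromSpec_injective {W : P.Opens} (hW : IsAffineOpen W) {R : CommRingCat.{u}}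
    {φ ψ : Γ(P, W) ⟶ R} (h : Spec.map φ ≫ hW.fromSpec = Spec.map ψ ≫ hW.fromSpec) : φ = ψ :=
  Spec.map_inj.1 ((cancel_mono _).1 h)

lemma exists_affineOpen_mem (x : P) : ∃ W : P.Opens, IsAffineOpen W ∧ x ∈ W := by
  obtain ⟨W, hW, hx, -⟩ := TopologicalSpace.Opens.isBasis_iff_nbhd.1 P.isBasis_affineOpens
    (TopologicalSpace.Opens.mem_top x)
  exact ⟨W, hW, hx⟩

instance specFieldSubsingleton (K : Type u) [Field K] : Subsingleton (Spec (CommRingCat.of K)) :=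
  inferInstanceAs (Subsingleton (PrimeSpectrum K))

instance specFieldNonempty (K : Type u) [Field K] : Nonempty (Spec (CommRingCat.of K)) :=
  inferInstanceAs (Nonempty (PrimeSpectrum K))

lemma exists_affineOpen_forall_mem (K : Type u) [Field K] (p : Spec (CommRingCat.of K) ⟶ P) :
    ∃ W : P.Opens, IsAffineOpen W ∧ ∀ x, p x ∈ W := by
  obtain ⟨x⟩ := specFieldNonempty K
  obtain ⟨W, hW, hx⟩ := exists_affineOpen_mem (p x)
  exact ⟨W, hW, fun y => Subsingleton.elim x y ▸ hx⟩

/-- The spectra are single points, so `p` and `q` land in a common affine open, where the claim is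
the injectivity of `j`. -/
lemma specMap_field_cancel {K' K : Type u} [Field K'] [Field K] (j : K' →+* K)
    {p q : Spec (CommRingCat.of K') ⟶ P}
    (h : Spec.map (CommRingCat.ofHom j) ≫ p = Spec.map (CommRingCat.ofHom j) ≫ q) : p = q := by
  obtain ⟨W, hW, hp⟩ := exists_affineOpen_forall_mem K' p
  have hq : ∀ x, q x ∈ W := by
    intro x
    obtain ⟨y⟩ := specFieldNonempty K
    have h1 := congr($h y)
    simp only [Scheme.Hom.comp_apply] at h1
    rw [Subsingleton.elim x (Spec.map (CommRingCat.ofHom j) y), ← h1]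
    exact hp _
  obtain ⟨φ, rfl⟩ := exists_eq_specMap_fromSpec hW p hp
  obtain ⟨ψ, rfl⟩ := exists_eq_specMap_fromSpec hW q hq
  rw [← Spec.map_comp_assoc, ← Spec.map_comp_assoc] at h
  have h2 := specMap_fromSpec_injective hW h
  congr 2
  ext a
  exact j.injective (congr($(h2) a))

/-- A point with values in a field `K` which is invariant under an endomorphism of `K` with field
of invariants `K'` is defined over `K'`. -/
lemma exists_descent {K' K : Type u} [Field K'] [Field K] (j : K' →+* K) (F : K →+* K)
    (hF : ∀ x, F x = x → x ∈ j.range) (p : Spec (CommRingCat.of K) ⟶ P)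
    (h : Spec.map (CommRingCat.ofHom F) ≫ p = p) :
    ∃ q : Spec (CommRingCat.of K') ⟶ P, Spec.map (CommRingCat.ofHom j) ≫ q = p := by
  obtain ⟨W, hW, hp⟩ := exists_affineOpen_forall_mem K p
  obtain ⟨φ, rfl⟩ := exists_eq_specMap_fromSpec hW p hp
  rw [← Spec.map_comp_assoc] at h
  have h2 := specMap_fromSpec_injective hW h
  have h3 : ∀ a, φ a ∈ j.range := fun a => hF _ (congr($(h2) a))
  let e : K' ≃+* j.range := RingEquiv.ofBijective j.rangeRestrict
    ⟨fun x y hxy => j.injective (congrArg Subtype.val hxy), j.rangeRestrict_surjective⟩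
  let ψ : Γ(P, W) →+* K' := e.symm.toRingHom.comp (φ.hom.codRestrict j.range h3)
  refine ⟨Spec.map (CommRingCat.ofHom ψ) ≫ hW.fromSpec, ?_⟩
  rw [← Spec.map_comp_assoc]
  congr 2
  ext a
  change ((e (e.symm _) : j.range) : K) = _
  rw [RingEquiv.apply_symm_apply]
  rfl

end AffinePoints

/-! ### Field-valued points of a quotient -/

section Quotient

variable {S : Scheme.{u}} {G : Type*} {P Y : Over S} {act : G → (P ⟶ P)} {π : P ⟶ Y}

lemma IsQuotient.comp_left (hπ : IsQuotient act π) (g : G) : (act g).left ≫ π.left = π.left := by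
  rw [← Over.comp_left, hπ.invariant]

lemma IsQuotient.preimage_le (hπ : IsQuotient act π) (V : Y.left.Opens) (g : G) :
    π.left ⁻¹ᵁ V ≤ (act g).left ⁻¹ᵁ (π.left ⁻¹ᵁ V) := by
  rw [← Scheme.Hom.comp_preimage, hπ.comp_left]

variable [Group G]

lemma IsQuotient.isInvariants (hπ : IsQuotient act π) (hact : IsAction fun g => (act g).left)
    (V : Y.left.Opens) :
    IsInvariants (sectionAction hact (π.left ⁻¹ᵁ V) (hπ.preimage_le V)) (π.left.app V).hom where
  injective := hπ.injective V
  map_apply g b := by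
    have h : ∀ (f : P.left ⟶ Y.left) (e : π.left ⁻¹ᵁ V ≤ f ⁻¹ᵁ V), f = π.left →
        f.appLE V (π.left ⁻¹ᵁ V) e = π.left.app V := by
      rintro f e rfl
      rw [Scheme.Hom.appLE_eq_app]
    have h2 := h _ (hπ.preimage_le V g) (hπ.comp_left g)
    rw [← Scheme.Hom.appLE_comp_appLE _ _ _ (π.left ⁻¹ᵁ V) _ le_rfl (hπ.preimage_le V g),
      Scheme.Hom.appLE_eq_app] at h2
    exact congr($h2 b)
  exists_eq a ha := hπ.exists_of_invariant V a fun g h => ha g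

/-- Over an affine neighbourhood of the image of `y` this is the extension of a homomorphism along
the integral inclusion of the invariants. -/
lemma IsQuotient.exists_lift [Finite G] (hπ : IsQuotient act π)
    (hact : IsAction fun g => (act g).left) {K : Type u} [Field K] [IsAlgClosed K]
    (y : Spec (CommRingCat.of K) ⟶ Y.left) :
    ∃ p : Spec (CommRingCat.of K) ⟶ P.left, p ≫ π.left = y := by
  have := hπ.affine
  obtain ⟨V, hV, hy⟩ := exists_affineOpen_forall_mem K y
  obtain ⟨β, rfl⟩ := exists_eq_specMap_fromSpec hV y hy
  have hinv := hπ.isInvariants hact V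
  obtain ⟨φ, hφ⟩ := exists_comp_eq_of_isIntegral hinv.isIntegral hinv.injective β.hom
  have hW := hV.preimage π.left
  refine ⟨Spec.map (CommRingCat.ofHom φ) ≫ hW.fromSpec, ?_⟩
  rw [Category.assoc, ← hV.SpecMap_appLE_fromSpec π.left hW le_rfl, ← Spec.map_comp_assoc,
    Scheme.Hom.appLE_eq_app]
  congr 2
  ext1
  exact hφ

/-- As `π` is affine, both points lie in the affine preimage of one affine open, where homomorphisms
agreeing on invariants are conjugate. -/
lemma IsQuotient.exists_eq_comp [Finite G] (hπ : IsQuotient act π)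
    (hact : IsAction fun g => (act g).left) {K : Type u} [Field K]
    {p p' : Spec (CommRingCat.of K) ⟶ P.left} (h : p ≫ π.left = p' ≫ π.left) :
    ∃ g, p' = p ≫ (act g).left := by
  have := hπ.affine
  obtain ⟨V, hV, hy⟩ := exists_affineOpen_forall_mem K (p ≫ π.left)
  have hW := hV.preimage π.left
  obtain ⟨φ, rfl⟩ := exists_eq_specMap_fromSpec hW p fun x => by simpa using hy x
  obtain ⟨ψ, rfl⟩ := exists_eq_specMap_fromSpec hW p' fun x => by
    have := hy x
    rw [h] at this
    simpa using this
  rw [Category.assoc, Category.assoc, ← hV.SpecMap_appLE_fromSpec π.left hW le_rfl,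
    ← Spec.map_comp_assoc, ← Spec.map_comp_assoc, Scheme.Hom.appLE_eq_app] at h
  have h2 := specMap_fromSpec_injective hV h
  obtain ⟨g, hg⟩ := (hπ.isInvariants hact V).exists_eq_comp (φ := φ.hom) (ψ := ψ.hom)
    (congrArg CommRingCat.Hom.hom h2)
  refine ⟨g, ?_⟩
  rw [Category.assoc, ← hW.SpecMap_appLE_fromSpec (act g).left hW (hπ.preimage_le V g),
    ← Spec.map_comp_assoc]
  congr 2
  ext1
  exact hg

end Quotient

/-! ### Functoriality of points in the field, and descent -/

section PointsFunctor

variable {k : Type u} [Field k] {X : Over (Spec (CommRingCat.of k))}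
  {K₁ K₂ K₃ : Type u} [Field K₁] [Algebra k K₁] [Field K₂] [Algebra k K₂] [Field K₃] [Algebra k K₃]

/-- The morphism of spectra over `k` induced by a homomorphism of extension fields of `k`. -/
noncomputable def specOver (α : K₁ →ₐ[k] K₂) :
    Over.mk (Spec.map (CommRingCat.ofHom (algebraMap k K₂))) ⟶
      Over.mk (Spec.map (CommRingCat.ofHom (algebraMap k K₁))) :=
  Over.homMk (Spec.map (CommRingCat.ofHom α.toRingHom)) (by
    change Spec.map _ ≫ Spec.map _ = Spec.map _
    rw [← Spec.map_comp, ← CommRingCat.ofHom_comp]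
    congr 2
    exact α.comp_algebraMap)

lemma specOver_id : specOver (AlgHom.id k K₁) = 𝟙 _ := by
  ext1
  exact Spec.map_id _

lemma specOver_comp (α : K₁ →ₐ[k] K₂) (β : K₂ →ₐ[k] K₃) :
    specOver (β.comp α) = specOver β ≫ specOver α := by
  ext1
  exact Spec.map_comp (CommRingCat.ofHom α.toRingHom) (CommRingCat.ofHom β.toRingHom)

variable (X) in
/-- The map on points induced by a homomorphism of extension fields. -/
noncomputable def pointsMap (α : K₁ →ₐ[k] K₂) (z : Points X K₁) : Points X K₂ := specOver α ≫ z

lemma pointsMap_iterate (α : K₁ →ₐ[k] K₁) (n : ℕ) :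
    (pointsMap X α)^[n] = pointsMap X (α ^ n) := by
  induction n with
  | zero =>
    funext z
    exact ((congrArg (· ≫ z) specOver_id).trans (Category.id_comp z)).symm
  | succ n ih =>
    funext z
    rw [Function.iterate_succ_apply', ih, pow_succ']
    exact ((congrArg (· ≫ z) (specOver_comp (α ^ n) α)).trans (Category.assoc _ _ _)).symm

lemma pointsMap_injective (α : K₁ →ₐ[k] K₂) : Function.Injective (pointsMap X α) := by
  intro z w h
  ext1
  exact specMap_field_cancel α.toRingHom (congrArg (fun f => Over.Hom.left f) h)

/-- A point invariant under `F` takes its values in the fixed field of `F`, which is the image of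
`j`. It is applied to powers of Frobenius on an algebraic closure. -/
lemma pointsMap_eq_iff_mem_range (j : K₁ →ₐ[k] K₂) (F : K₂ →ₐ[k] K₂)
    (hF : ∀ x, F x = x ↔ x ∈ j.range) (z : Points X K₂) :
    pointsMap X F z = z ↔ z ∈ Set.range (pointsMap X j) := by
  constructor
  · intro h
    obtain ⟨q, hq⟩ := exists_descent j.toRingHom F.toRingHom (fun x hx => (hF x).1 hx) z.left
      (congrArg (fun f => Over.Hom.left f) h)
    refine ⟨Over.homMk q ?_, ?_⟩
    · apply specMap_field_cancel j.toRingHom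
      rw [← Category.assoc, hq]
      exact (Over.w z).trans (Over.w (specOver j)).symm
    · ext1
      exact hq
  · rintro ⟨w, rfl⟩
    change specOver F ≫ specOver j ≫ w = specOver j ≫ w
    rw [← Category.assoc, ← specOver_comp]
    congr 2
    ext x
    exact (hF (j x)).2 ⟨x, rfl⟩

lemma ncard_fixed_eq (j : K₁ →ₐ[k] K₂) (F : K₂ →ₐ[k] K₂)
    (hF : ∀ x, F x = x ↔ x ∈ j.range) :
    {z | pointsMap X F z = z}.ncard = Nat.card (Points X K₁) := by
  have : {z | pointsMap X F z = z} = Set.range (pointsMap X j) :=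
    Set.ext fun z => pointsMap_eq_iff_mem_range j F hF z
  rw [this, ← Nat.card_coe_set_eq, Nat.card_range_of_injective (pointsMap_injective j)]

lemma finite_fixed_iff (j : K₁ →ₐ[k] K₂) (F : K₂ →ₐ[k] K₂)
    (hF : ∀ x, F x = x ↔ x ∈ j.range) :
    {z | pointsMap X F z = z}.Finite ↔ Finite (Points X K₁) := by
  have : {z | pointsMap X F z = z} = Set.range (pointsMap X j) :=
    Set.ext fun z => pointsMap_eq_iff_mem_range j F hF z
  rw [this]
  exact Set.finite_range_iff (pointsMap_injective j)

end PointsFunctor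

/-! ### Finiteness of the set of points over a finite field -/

section FinitePoints

/-- Such a homomorphism is determined by its values on finitely many generators. -/
lemma finite_ringHom_of_finiteType {R A K : Type*} [CommRing R] [CommRing A] [CommRing K]
    [Finite K] {c : R →+* A} (hc : c.FiniteType) (β : R →+* K) :
    {φ : A →+* K | φ.comp c = β}.Finite := by
  let := c.toAlgebra
  let := β.toAlgebra
  obtain ⟨s, hs⟩ := hc.out
  have hfin : Finite (s → K) := inferInstance
  refine Set.Finite.of_injOn (f := fun (φ : A →+* K) (x : s) => φ x) (t := Set.univ)
    (fun _ _ => Set.mem_univ _) ?_ Set.finite_univ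
  intro φ hφ ψ hψ h
  let φ' : A →ₐ[R] K := ⟨φ, fun r => RingHom.congr_fun hφ r⟩
  let ψ' : A →ₐ[R] K := ⟨ψ, fun r => RingHom.congr_fun hψ r⟩
  have : φ' = ψ' := AlgHom.ext_of_adjoin_eq_top hs fun x hx => congrFun h ⟨x, hx⟩
  exact congrArg (fun f : A →ₐ[R] K => f.toRingHom) this

/-- A scheme of finite type over `k` has finitely many points with values in a finite field. -/
lemma finite_points {k : Type u} [Field k] (X : Over (Spec (CommRingCat.of k)))
    [LocallyOfFiniteType X.hom] [QuasiCompact X.hom] (K : Type u) [Field K] [Algebra k K]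
    [Finite K] : Finite (Points X K) := by
  have hcomp : CompactSpace X.left := by
    rw [← quasiCompact_iff_compactSpace (f := X.hom)]
    infer_instance
  have hloc : ∀ W : X.left.Opens, IsAffineOpen W →
      {z : Points X K | ∀ x, z.left x ∈ W}.Finite := by
    intro W hW
    have htop := isAffineOpen_top (Spec (CommRingCat.of k))
    obtain ⟨β, hβ⟩ := exists_eq_specMap_fromSpec htop
      (Spec.map (CommRingCat.ofHom (algebraMap k K))) fun _ => trivial
    have hft := X.hom.finiteType_appLE htop hW le_top
    have hex : ∀ z : {z : Points X K | ∀ x, z.left x ∈ W},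
        ∃ φ : Γ(X.left, W) ⟶ CommRingCat.of K, z.1.left = Spec.map φ ≫ hW.fromSpec ∧
          φ.hom.comp (X.hom.appLE ⊤ W le_top).hom = β.hom := by
      rintro ⟨z, hz⟩
      obtain ⟨φ, hφ⟩ := exists_eq_specMap_fromSpec hW z.left hz
      refine ⟨φ, hφ, ?_⟩
      have h1 : z.left ≫ X.hom = Spec.map (CommRingCat.ofHom (algebraMap k K)) := Over.w z
      rw [hφ, Category.assoc, ← htop.SpecMap_appLE_fromSpec X.hom hW le_top, hβ,
        ← Spec.map_comp_assoc] at h1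
      exact congrArg CommRingCat.Hom.hom (specMap_fromSpec_injective htop h1)
    choose φ hφ hβφ using hex
    have := (finite_ringHom_of_finiteType hft β.hom).to_subtype
    refine Set.finite_coe_iff.1 (Finite.of_injective
      (β := {φ : Γ(X.left, W) →+* K | φ.comp (X.hom.appLE ⊤ W le_top).hom = β.hom})
      (fun z => ⟨(φ z).hom, hβφ z⟩) ?_)
    intro z w h
    ext1
    ext1
    rw [hφ z, hφ w, CommRingCat.hom_ext (congrArg Subtype.val h)]
  choose W hW hxW using fun x : X.left => exists_affineOpen_mem x
  obtain ⟨t, ht⟩ := isCompact_univ.elim_finite_subcover (fun x => (W x : Set X.left))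
    (fun x => (W x).isOpen) fun x _ => Set.mem_iUnion.2 ⟨x, hxW x⟩
  rw [← Set.finite_univ_iff]
  refine (t.finite_toSet.biUnion fun x _ => hloc (W x) (hW x)).subset ?_
  intro z _
  obtain ⟨x⟩ := specFieldNonempty K
  obtain ⟨y, hy, hzy⟩ := Set.mem_iUnion₂.1 (ht (Set.mem_univ (z.left x)))
  exact Set.mem_iUnion₂.2 ⟨y, hy, fun x' => Subsingleton.elim x x' ▸ hzy⟩

end FinitePoints

/-! ### Finite fields as fixed fields of powers of Frobenius -/

section FiniteFields

open Polynomial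

variable (k : Type u) [Field k] [Fintype k]

lemma frobenius_pow_apply {A : Type*} [CommRing A] [Algebra k A] (n : ℕ) (x : A) :
    (FiniteField.frobeniusAlgHom k A ^ n) x = x ^ (Nat.card k ^ n) := by
  rw [AlgHom.coe_pow, FiniteField.coe_frobeniusAlgHom, pow_iterate, Nat.card_eq_fintype_card]

/-- The fixed elements are the roots of `X ^ (q ^ n) - X`, which is nonzero since `1 ≤ n` and
already splits in `K'`, so no new roots appear in `K`. -/
lemma mem_range_of_pow_card_eq {K' K : Type*} [Field K'] [Algebra k K'] [Field K] [Algebra k K]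
    {n : ℕ} (hn : 1 ≤ n)
    (hs : ((X ^ (Nat.card k ^ n) - X : k[X]).map (algebraMap k K')).Splits)
    (hK' : ∀ x : K', x ^ (Nat.card k ^ n) = x) (j : K' →ₐ[k] K) (x : K) :
    (FiniteField.frobeniusAlgHom k K ^ n) x = x ↔ x ∈ j.range := by
  rw [frobenius_pow_apply]
  have hq : 1 < Nat.card k := Finite.one_lt_card
  constructor
  · intro hx
    refine hs.mem_range_of_isRoot (i := j.toRingHom) ?_ ?_
    · refine (Polynomial.map_ne_zero_iff (algebraMap k K').injective).2 ?_
      exact FiniteField.X_pow_card_sub_X_ne_zero _ (Nat.one_lt_pow (by omega) hq)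
    · rw [Polynomial.map_map, Polynomial.IsRoot.def, Polynomial.map_sub, Polynomial.map_pow,
        Polynomial.map_X, Polynomial.eval_sub, Polynomial.eval_pow, Polynomial.eval_X, hx, sub_self]
  · rintro ⟨y, rfl⟩
    change j y ^ _ = j y
    rw [← map_pow, hK']

/-- The `n`-th power of Frobenius fixes the roots of the defining polynomial, and these generate the
splitting field. -/
lemma ext_pow_card_eq (n : ℕ) (x : Ext k n) : x ^ (Nat.card k ^ n) = x := by
  have hq : 1 < Nat.card k := Finite.one_lt_card
  have : FiniteField.frobeniusAlgHom k (Ext k n) ^ n = AlgHom.id k (Ext k n) := by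
    refine AlgHom.ext_of_adjoin_eq_top
      (Polynomial.SplittingField.adjoin_rootSet (X ^ (Nat.card k ^ n) - X : k[X])) ?_
    intro x hx
    rw [frobenius_pow_apply]
    have := (Polynomial.mem_rootSet.1 hx).2
    simpa [sub_eq_zero] using this
  rw [← frobenius_pow_apply, this]
  rfl

end FiniteFields

/-! ### Points of symmetric products as multisets of points -/

lemma map_univ_eq_map_univ_iff {ι α : Type*} [Fintype ι] {a b : ι → α} :
    Finset.univ.val.map a = Finset.univ.val.map b ↔ ∃ σ : Equiv.Perm ι, b = a ∘ σ := by
  classical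
  constructor
  · intro h
    -- Equal multiplicities mean fibres of equal size; bijections between the fibres assemble to a
    -- permutation.
    have hc : ∀ c, Nonempty ({x // b x = c} ≃ {x // a x = c}) := by
      intro c
      rw [← Fintype.card_eq, Fintype.card_subtype, Fintype.card_subtype]
      have := congrArg (Multiset.count c) h
      rw [Multiset.count_map, Multiset.count_map] at this
      simp only [eq_comm (a := c)] at this
      exact this.symm
    refine ⟨Equiv.ofFiberEquiv fun c => (hc c).some, ?_⟩
    funext x
    exact (Equiv.ofFiberEquiv_map _ x).symm
  · rintro ⟨σ, rfl⟩
    rw [← Multiset.map_map]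
    congr 1
    exact (congrArg Finset.val (Finset.map_univ_equiv σ)).symm

lemma exists_map_univ_eq {α : Type*} (m : Multiset α) :
    ∃ a : Fin m.card → α, Finset.univ.val.map a = m := by
  induction m using Quot.inductionOn with
  | h l =>
    refine ⟨l.get, ?_⟩
    change Multiset.map l.get ↑(List.finRange l.length) = _
    rw [Multiset.map_coe, ← List.ofFn_eq_map, List.ofFn_get]
    rfl

section Permute

variable {S : Scheme.{u}} (X : Over S) (n : ℕ)

lemma lift_permute {T : Over S} (a : Fin n → (T ⟶ X)) (σ : Equiv.Perm (Fin n)) :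
    Pi.lift a ≫ permute X n σ = Pi.lift (a ∘ σ) := by
  refine Pi.hom_ext _ _ fun i => ?_
  rw [Category.assoc, permute, Pi.lift_π, Pi.lift_π, Pi.lift_π]
  rfl

lemma permute_one : permute X n 1 = 𝟙 _ := by
  refine Pi.hom_ext _ _ fun i => ?_
  rw [permute, Pi.lift_π, Category.id_comp]
  rfl

lemma permute_mul (σ τ : Equiv.Perm (Fin n)) :
    permute X n (σ * τ) = permute X n σ ≫ permute X n τ := by
  conv_rhs => rw [permute, lift_permute]
  rfl

lemma isAction_permute : IsAction fun σ => (permute X n σ).left where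
  map_one := by rw [permute_one, Over.id_left]
  map_mul σ τ := by rw [permute_mul, Over.comp_left]

end Permute

section Counting

variable {k : Type u} [Field k] {X : Over (Spec (CommRingCat.of k))} {n : ℕ}
  {Y : Over (Spec (CommRingCat.of k))} {π : power X n ⟶ Y}

/-- The point of the symmetric product given by `n` points of `X`. -/
noncomputable def sumPoint (π : power X n ⟶ Y) {K : Type u} [Field K] [Algebra k K]
    (a : Fin n → Points X K) : Points Y K :=
  Pi.lift a ≫ π

lemma pointsMap_sumPoint {K₁ K₂ : Type u} [Field K₁] [Algebra k K₁] [Field K₂] [Algebra k K₂]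
    (α : K₁ →ₐ[k] K₂) (a : Fin n → Points X K₁) :
    pointsMap Y α (sumPoint π a) = sumPoint π (pointsMap X α ∘ a) := by
  unfold pointsMap sumPoint
  rw [← Category.assoc]
  congr 1
  refine Pi.hom_ext _ _ fun i => ?_
  rw [Category.assoc, Pi.lift_π, Pi.lift_π]
  rfl

variable {K : Type u} [Field K] [Algebra k K]

lemma sumPoint_surjective [IsAlgClosed K] (hπ : IsSymmetricProduct X n π) :
    Function.Surjective (sumPoint π (K := K)) := by
  intro y
  obtain ⟨p, hp⟩ := IsQuotient.exists_lift hπ (isAction_permute X n) y.left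
  have hw : p ≫ (power X n).hom = Spec.map (CommRingCat.ofHom (algebraMap k K)) := by
    rw [← Over.w π, ← Category.assoc, hp]
    exact Over.w y
  let p' : Points (power X n) K := Over.homMk p hw
  refine ⟨fun i => p' ≫ Pi.π _ i, ?_⟩
  have h1 : Pi.lift (fun i => p' ≫ Pi.π (fun _ : Fin n => X) i) = p' :=
    Pi.hom_ext _ _ fun i => Pi.lift_π _ _
  rw [sumPoint, h1]
  ext1
  exact hp

/-- The fibres of `π` on points are the orbits of the symmetric group on tuples, and such an orbit
is a multiset. -/
lemma sumPoint_eq_iff (hπ : IsSymmetricProduct X n π) {a b : Fin n → Points X K} :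
    sumPoint π a = sumPoint π b ↔ Finset.univ.val.map a = Finset.univ.val.map b := by
  rw [map_univ_eq_map_univ_iff]
  constructor
  · intro h
    obtain ⟨σ, hσ⟩ := IsQuotient.exists_eq_comp hπ (isAction_permute X n)
      (p := (Pi.lift a).left) (p' := (Pi.lift b).left) (congrArg (fun f => Over.Hom.left f) h)
    refine ⟨σ, ?_⟩
    have h1 : Pi.lift b = Pi.lift a ≫ permute X n σ := by
      refine Over.OverMorphism.ext ?_
      exact hσ
    rw [lift_permute] at h1
    funext i
    have := congrArg (· ≫ Pi.π (fun _ : Fin n => X) i) h1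
    simp only [Pi.lift_π] at this
    exact this
  · rintro ⟨σ, rfl⟩
    rw [sumPoint, sumPoint, ← lift_permute, Category.assoc, hπ.invariant]

/-- The fixed points on the symmetric product correspond to the invariant multisets. -/
lemma nonempty_fixed_equiv [IsAlgClosed K] (hπ : IsSymmetricProduct X n π) (F : K →ₐ[k] K) :
    Nonempty ({y | pointsMap Y F y = y} ≃ invMultisets (pointsMap X F) n) := by
  choose s hs using sumPoint_surjective (K := K) hπ
  refine ⟨Equiv.ofBijective
    (fun y => ⟨Finset.univ.val.map (s y.1), by simp, ?_⟩) ⟨?_, ?_⟩⟩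
  · rw [Multiset.map_map, ← sumPoint_eq_iff hπ, ← pointsMap_sumPoint, hs]
    exact y.2
  · intro y y' h
    have h1 := (sumPoint_eq_iff hπ).2 (congrArg Subtype.val h)
    rw [hs, hs] at h1
    exact Subtype.ext h1
  · rintro ⟨m, rfl, hm⟩
    obtain ⟨a, ha⟩ := exists_map_univ_eq m
    refine ⟨⟨sumPoint π a, ?_⟩, ?_⟩
    · change pointsMap Y F _ = _
      rw [pointsMap_sumPoint, sumPoint_eq_iff hπ, ← Multiset.map_map, ha, hm]
    · refine Subtype.ext (Eq.trans ?_ ha)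
      exact (sumPoint_eq_iff hπ).1 (hs _)

end Counting

/-- The generating series of the numbers of rational points of the symmetric products is the
Hasse-Weil zeta function. -/
lemma mk_card_points_eq_hasseWeil (k : Type u) [Field k] [Finite k]
    (X : Over (Spec (CommRingCat.of k))) (hX : ∀ n, Finite (Points X (Ext k n)))
    (Y : ℕ → Over (Spec (CommRingCat.of k))) (π : ∀ n, power X n ⟶ Y n)
    (hπ : ∀ n, IsSymmetricProduct X n (π n)) :
    (∀ n, Finite (Points (Y n) k)) ∧
      PowerSeries.mk (fun n => (Nat.card (Points (Y n) k) : ℚ)) = hasseWeil X := by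
  cases nonempty_fintype k
  let K := AlgebraicClosure k
  let F : K →ₐ[k] K := FiniteField.frobeniusAlgHom k K
  -- Here `k` itself serves as the field with `q ^ 1` elements.
  have hk : ∀ x, F x = x ↔ x ∈ (Algebra.ofId k K).range := by
    intro x
    have hs : ((Polynomial.X ^ (Nat.card k ^ 1) - Polynomial.X : Polynomial k).map
        (algebraMap k k)).Splits := by
      rw [pow_one, Nat.card_eq_fintype_card]
      exact (FiniteField.isSplittingField_sub k k).splits
    have := mem_range_of_pow_card_eq k le_rfl hs
      (fun x => by rw [pow_one, Nat.card_eq_fintype_card, FiniteField.pow_card])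
      (Algebra.ofId k K) x
    rwa [pow_one] at this
  have hExt : ∀ n, 1 ≤ n → ∃ j : Ext k n →ₐ[k] K, ∀ x, (F ^ n) x = x ↔ x ∈ j.range := fun n hn =>
    ⟨IsAlgClosed.lift, mem_range_of_pow_card_eq k hn (Polynomial.SplittingField.splits _)
      (ext_pow_card_eq k n) _⟩
  have hinj : Function.Injective (pointsMap X F) := pointsMap_injective F
  have hfix : ∀ n, 1 ≤ n → {z | (pointsMap X F)^[n] z = z}.Finite := by
    intro n hn
    obtain ⟨j, hj⟩ := hExt n hn
    rw [pointsMap_iterate, finite_fixed_iff j _ hj]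
    exact hX n
  have hcard : ∀ n, 1 ≤ n →
      {z | (pointsMap X F)^[n] z = z}.ncard = Nat.card (Points X (Ext k n)) := by
    intro n hn
    obtain ⟨j, hj⟩ := hExt n hn
    rw [pointsMap_iterate, ncard_fixed_eq j _ hj]
  have hY : ∀ n, Nat.card (Points (Y n) k) = (invMultisets (pointsMap X F) n).ncard := by
    intro n
    obtain ⟨e⟩ := nonempty_fixed_equiv (K := K) (hπ n) F
    rw [← ncard_fixed_eq (Algebra.ofId k K) F hk, ← Nat.card_coe_set_eq, ← Nat.card_coe_set_eq,
      Nat.card_congr e]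
  refine ⟨fun n => ?_, ?_⟩
  · obtain ⟨e⟩ := nonempty_fixed_equiv (K := K) (hπ n) F
    rw [← finite_fixed_iff (Algebra.ofId k K) F hk]
    have := (finite_invMultisets hinj hfix n).to_subtype
    exact Set.finite_coe_iff.1 (Finite.of_equiv _ e.symm)
  · simp only [hY]
    refine mk_eq_exp_subst_of_recurrence ncard_invMultisets_zero fun n => ?_
    rw [card_invMultisets_recurrence hinj hfix]
    refine Finset.sum_congr rfl fun j hj => ?_
    rw [hcard j (Finset.mem_Icc.1 hj).1]

/-! ### Criteria for open immersions -/

lemma isOpenImmersion_of_isLocalIso {X Y : Scheme.{u}} (f : X ⟶ Y) [h : IsLocalIso f]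
    (hf : Function.Injective f) : IsOpenImmersion f := by
  have key : ∀ x, IsIso (f.stalkMap x) ∧ nhds (f x) ≤ Filter.map f (nhds x) := by
    intro x
    obtain ⟨U, hxU, hU⟩ := h.exists_isOpenImmersion x
    obtain ⟨y, rfl⟩ : ∃ y, U.ι y = x := ⟨⟨x, hxU⟩, rfl⟩
    constructor
    · have h1 : IsIso ((U.ι ≫ f).stalkMap y) := inferInstance
      have h2 : IsIso (U.ι.stalkMap y) := inferInstance
      rw [Scheme.Hom.stalkMap_comp] at h1
      exact @IsIso.of_isIso_comp_right _ _ _ _ _ _ _ h2 h1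
    · have h1 := (U.ι ≫ f).isOpenEmbedding.map_nhds_eq y
      have h2 := U.ι.isOpenEmbedding.map_nhds_eq y
      rw [← h2, Filter.map_map]
      exact h1.ge
  have := fun x => (key x).1
  exact IsOpenImmersion.of_isIso_stalkMap f
    (Topology.IsOpenEmbedding.of_continuous_injective_isOpenMap f.continuous hf
      (isOpenMap_iff_nhds_le.2 fun x => (key x).2))

/-- If `s : B ⟶ B'` becomes bijective after inverting `f`, then `Spec s` is an open immersion on
the basic open subset defined by `f`. -/
lemma isOpenImmersion_specMap_localization {B B' : CommRingCat.{u}} (s : B ⟶ B') (f : B)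
    (hinj : ∀ b, s b = 0 → ∃ n : ℕ, f ^ n * b = 0)
    (hsurj : ∀ b', ∃ (n : ℕ) (b : B), s b = s f ^ n * b') :
    IsOpenImmersion (Spec.map (CommRingCat.ofHom (algebraMap B' (Localization.Away (s f)))) ≫
      Spec.map s) := by
  let L := Localization.Away (s f)
  let : Algebra B L := ((algebraMap B' L).comp s.hom).toAlgebra
  have hu : IsUnit (algebraMap B' L (s f)) := IsLocalization.Away.algebraMap_isUnit (s f)
  -- The localization of `B'` at `s f` is also the localization of `B` at `f`.
  have : IsLocalization.Away f L := by
    refine IsLocalization.Away.mk f hu ?_ ?_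
    · intro z
      obtain ⟨n, b', hb'⟩ := IsLocalization.Away.surj (s f) z
      obtain ⟨m, b, hb⟩ := hsurj b'
      refine ⟨n + m, b, ?_⟩
      change z * (algebraMap B' L (s f)) ^ (n + m) = algebraMap B' L (s b)
      rw [pow_add, ← mul_assoc, hb', hb, map_mul, map_pow, mul_comm]
    · intro a b hab
      change algebraMap B' L (s a) = algebraMap B' L (s b) at hab
      obtain ⟨n, hn⟩ := IsLocalization.Away.exists_of_eq (s f) hab
      obtain ⟨m, hm⟩ := hinj (f ^ n * (a - b)) (by
        rw [map_mul, map_pow, map_sub, mul_sub, hn, sub_self])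
      refine ⟨m + n, ?_⟩
      rw [← sub_eq_zero, ← mul_sub, pow_add, mul_assoc, hm]
  rw [← Spec.map_comp]
  exact IsOpenImmersion.of_isLocalization (R := B) (S := L) f

/-! ### Local quotients of invariant affine opens -/

section Gluing

variable {P : Scheme.{u}} {G : Type*} {ρ : G → (P ⟶ P)}

variable (ρ) in
/-- The invariant affine open subsets. -/
structure InvAffine where
  opens : P.Opens
  isAffineOpen : IsAffineOpen opens
  le_preimage : ∀ g, opens ≤ ρ g ⁻¹ᵁ opens

instance : Preorder (InvAffine ρ) := Preorder.lift InvAffine.opens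

namespace InvAffine

section

variable {W W' W'' : InvAffine ρ}

/-- The restriction of sections. -/
def res (h : W ≤ W') : Γ(P, W'.1) ⟶ Γ(P, W.1) := P.presheaf.map (homOfLE h : W.1 ⟶ W'.1).op

lemma res_comp (h : W ≤ W') (h' : W' ≤ W'') : res h' ≫ res h = res (h.trans h') := by
  rw [res, res, ← Functor.map_comp]
  rfl

lemma res_refl (W : InvAffine ρ) : res (le_refl W) = 𝟙 _ := P.presheaf.map_id _

variable (W) in
/-- The inclusion of an invariant affine open subset. -/
noncomputable def emb : Spec Γ(P, W.1) ⟶ P := W.2.fromSpec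

instance (W : InvAffine ρ) : IsOpenImmersion W.emb := W.2.isOpenImmersion_fromSpec

lemma range_emb (W : InvAffine ρ) : Set.range W.emb = W.1 := W.2.range_fromSpec

lemma emb_mem (W : InvAffine ρ) (z : Spec Γ(P, W.1)) : W.emb z ∈ W.1 := by
  have : W.emb z ∈ Set.range W.emb := ⟨z, rfl⟩
  rwa [range_emb] at this

lemma exists_emb_eq (W : InvAffine ρ) {x : P} (hx : x ∈ W.1) : ∃ z, W.emb z = x := by
  have : x ∈ Set.range W.emb := by rwa [range_emb]
  exact this

lemma emb_injective (W : InvAffine ρ) : Function.Injective W.emb :=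
  W.emb.isOpenEmbedding.injective

lemma specMap_res_emb (h : W ≤ W') : Spec.map (res h) ≫ W'.emb = W.emb :=
  W'.2.map_fromSpec W.2 _

lemma specMap_act_emb (W : InvAffine ρ) (g : G) :
    Spec.map ((ρ g).appLE W.1 W.1 (W.3 g)) ≫ W.emb = W.emb ≫ ρ g :=
  W.2.SpecMap_appLE_fromSpec (ρ g) W.2 (W.3 g)

end

variable [Group G] (hρ : IsAction ρ) (W : InvAffine ρ)

/-- The invariant sections over an invariant affine open subset. -/
def invRing : Subring Γ(P, W.1) where
  carrier := {s | ∀ g, sectionAction hρ W.1 W.3 g s = s}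
  mul_mem' ha hb g := by rw [map_mul, ha g, hb g]
  one_mem' g := map_one _
  add_mem' ha hb g := by rw [map_add, ha g, hb g]
  zero_mem' g := map_zero _
  neg_mem' ha g := by rw [map_neg, ha g]

lemma isInvariants : IsInvariants (sectionAction hρ W.1 W.3) (W.invRing hρ).subtype where
  injective := Subtype.val_injective
  map_apply g b := b.2 g
  exists_eq a ha := ⟨⟨a, ha⟩, rfl⟩

/-- The inclusion of the ring of invariant sections. -/
def incl : CommRingCat.of (W.invRing hρ) ⟶ Γ(P, W.1) :=
  CommRingCat.ofHom (W.invRing hρ).subtype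

variable {W} {W' : InvAffine ρ}

lemma res_sectionAction (h : W ≤ W') (g : G) :
    (res h).hom.comp (sectionAction hρ W'.1 W'.3 g) =
      (sectionAction hρ W.1 W.3 g).comp (res h).hom := by
  have h1 : (ρ g).appLE W'.1 W'.1 (W'.3 g) ≫ res h =
      res h ≫ (ρ g).appLE W.1 W.1 (W.3 g) := by
    rw [res, Scheme.Hom.appLE_map, Scheme.Hom.map_appLE]
  exact congrArg CommRingCat.Hom.hom h1

/-- The restriction of invariant sections. -/
def invRes (h : W ≤ W') :
    CommRingCat.of (W'.invRing hρ) ⟶ CommRingCat.of (W.invRing hρ) :=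
  CommRingCat.ofHom (((res h).hom.comp (W'.invRing hρ).subtype).codRestrict _ fun s g =>
    (RingHom.congr_fun (res_sectionAction hρ h g) s.1).symm.trans
      (congrArg (res h) (s.2 g)))

lemma invRes_incl (h : W ≤ W') : invRes hρ h ≫ W.incl hρ = W'.incl hρ ≫ res h := rfl

instance (W : InvAffine ρ) : Mono (W.incl hρ) :=
  ConcreteCategory.mono_of_injective _ Subtype.val_injective

variable (ρ) in
/-- The local quotients. -/
noncomputable def quotientFunctor : InvAffine ρ ⥤ Scheme.{u} where
  obj W := Spec (CommRingCat.of (W.invRing hρ))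
  map f := Spec.map (invRes hρ (leOfHom f))
  map_id W := by
    rw [← Spec.map_id, Spec.map_inj, ← cancel_mono (W.incl hρ), invRes_incl, res_refl]
    rfl
  map_comp {W W' W''} f f' := by
    rw [← Spec.map_comp, Spec.map_inj, ← cancel_mono (W.incl hρ), Category.assoc, invRes_incl,
      invRes_incl, ← Category.assoc, invRes_incl, Category.assoc, res_comp]

variable (W) in
/-- The local quotient map. -/
noncomputable def quot : Spec Γ(P, W.1) ⟶ (quotientFunctor ρ hρ).obj W := Spec.map (W.incl hρ)

lemma specMap_res_quot (h : W ≤ W') :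
    Spec.map (res h) ≫ W'.quot hρ = W.quot hρ ≫ (quotientFunctor ρ hρ).map (homOfLE h) := by
  change Spec.map (res h) ≫ Spec.map (W'.incl hρ) = Spec.map (W.incl hρ) ≫ Spec.map (invRes hρ h)
  rw [← Spec.map_comp, ← Spec.map_comp, invRes_incl]

lemma specMap_act_quot (W : InvAffine ρ) (g : G) :
    Spec.map ((ρ g).appLE W.1 W.1 (W.3 g)) ≫ W.quot hρ = W.quot hρ := by
  change Spec.map _ ≫ Spec.map (W.incl hρ) = Spec.map (W.incl hρ)
  rw [← Spec.map_comp]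
  congr 1
  ext b
  exact b.2 g

lemma quot_eq_of_emb_eq (W : InvAffine ρ) {z z' : Spec Γ(P, W.1)} {g : G}
    (h : W.emb z' = ρ g (W.emb z)) : W.quot hρ z = W.quot hρ z' := by
  have h1 : z' = Spec.map ((ρ g).appLE W.1 W.1 (W.3 g)) z := by
    apply W.emb_injective
    rw [h, ← Scheme.Hom.comp_apply, ← Scheme.Hom.comp_apply, specMap_act_emb]
  rw [h1, ← Scheme.Hom.comp_apply, specMap_act_quot]

section

variable [Finite G]

lemma quot_surjective (W : InvAffine ρ) : Function.Surjective (W.quot hρ) :=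
  (W.isInvariants hρ).comap_surjective

/-- Together with `quot_eq_of_emb_eq` this says that the fibres of the local quotient map are the
orbits. -/
lemma exists_emb_eq_of_quot_eq (W : InvAffine ρ) {z z' : Spec Γ(P, W.1)}
    (h : W.quot hρ z = W.quot hρ z') : ∃ g, W.emb z' = ρ g (W.emb z) := by
  obtain ⟨g, hg⟩ := (W.isInvariants hρ).exists_comap_eq (p := z) (q := z') h
  refine ⟨g, ?_⟩
  have h1 : z' = Spec.map ((ρ g).appLE W.1 W.1 (W.3 g)) z := hg
  rw [h1, ← Scheme.Hom.comp_apply, ← Scheme.Hom.comp_apply, specMap_act_emb]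

/-- The invariant functions separate invariant open subsets from points. -/
lemma exists_basicOpen_le (W : InvAffine ρ) {O : P.Opens} (hO : ∀ g, O ≤ ρ g ⁻¹ᵁ O) {x : P}
    (hxW : x ∈ W.1) (hxO : x ∈ O) :
    ∃ f : W.invRing hρ, x ∈ P.basicOpen f.1 ∧ P.basicOpen f.1 ≤ O := by
  obtain ⟨z, rfl⟩ := W.exists_emb_eq hxW
  let C : Set (PrimeSpectrum Γ(P, W.1)) := {z | W.emb z ∉ O}
  have hC : IsClosed C := by
    have : IsOpen (W.emb ⁻¹' (O : Set P)) := O.isOpen.preimage W.emb.continuous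
    exact isClosed_compl_iff.2 this
  -- The integral quotient map is closed, so the complement of `O` has closed image. The image of
  -- `z` avoids it, since fibres are orbits and `O` is invariant; a basic open around that image
  -- gives `f`.
  have hC' := PrimeSpectrum.isClosedMap_comap_of_isIntegral _ (W.isInvariants hρ).isIntegral C hC
  have hz : PrimeSpectrum.comap (W.invRing hρ).subtype z ∉
      PrimeSpectrum.comap (W.invRing hρ).subtype '' C := by
    rintro ⟨z', hz', h⟩
    obtain ⟨g, hg⟩ := W.exists_emb_eq_of_quot_eq hρ (z := z) (z' := z') h.symm
    apply hz'
    rw [hg]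
    exact hO g hxO
  obtain ⟨_, ⟨f, rfl⟩, hzf, hf⟩ :=
    PrimeSpectrum.isTopologicalBasis_basic_opens.exists_subset_of_mem_open hz hC'.isOpen_compl
  have key : ∀ w : Spec Γ(P, W.1), W.emb w ∈ P.basicOpen f.1 ↔
      PrimeSpectrum.comap (W.invRing hρ).subtype w ∈ PrimeSpectrum.basicOpen f := by
    intro w
    have := W.2.fromSpec_preimage_basicOpen f.1
    have h2 : w ∈ W.2.fromSpec ⁻¹ᵁ P.basicOpen f.1 ↔ w ∈ PrimeSpectrum.basicOpen f.1 := by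
      rw [this]
      rfl
    exact h2
  refine ⟨f, (key z).2 hzf, ?_⟩
  intro y hy
  obtain ⟨w, rfl⟩ := W.exists_emb_eq (P.basicOpen_le f.1 hy)
  by_contra hw
  exact hf ((key w).1 hy) ⟨w, hw, rfl⟩

end

/-- The basic open subset defined by an invariant section. -/
def basicOpen (W : InvAffine ρ) (f : W.invRing hρ) : InvAffine ρ :=
  ⟨P.basicOpen f.1, W.2.basicOpen f.1, fun g => by
    have h1 : (ρ g).appLE W.1 W.1 (W.3 g) f.1 = f.1 := f.2 g
    rw [Scheme.preimage_basicOpen]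
    conv_lhs => rw [← h1]
    rw [Scheme.Hom.appLE, CommRingCat.comp_apply, Scheme.basicOpen_res]
    exact inf_le_right⟩

lemma basicOpen_le (W : InvAffine ρ) (f : W.invRing hρ) : W.basicOpen hρ f ≤ W :=
  P.basicOpen_le f.1

/-- The intersection of two affine opens need not be affine, so one passes to the basic open of an
invariant function. -/
lemma exists_le_le [Finite G] (hρ : IsAction ρ) (W W' : InvAffine ρ) {x : P} (hx : x ∈ W.1)
    (hx' : x ∈ W'.1) : ∃ W'' : InvAffine ρ, W'' ≤ W ∧ W'' ≤ W' ∧ x ∈ W''.1 := by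
  obtain ⟨f, hxf, hf⟩ := W.exists_basicOpen_le hρ W'.3 hx hx'
  exact ⟨W.basicOpen hρ f, W.basicOpen_le hρ f, hf, hxf⟩

end InvAffine

end Gluing

/-! ### The local quotients form a locally directed diagram of open immersions -/

section Gluing

variable {P : Scheme.{u}} {G : Type*} {ρ : G → (P ⟶ P)}

namespace InvAffine

lemma emb_specMap_res {W W' : InvAffine ρ} (h : W ≤ W') (z : Spec Γ(P, W.1)) :
    W'.emb (Spec.map (res h) z) = W.emb z := by
  rw [← Scheme.Hom.comp_apply, specMap_res_emb]

/-- The basic open of `f` is the same in `W` and in `W'`, so restriction becomes bijective once `f`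
is inverted. The form with cleared denominators is the one `localization_lift` transfers to
invariants. -/
lemma res_localization {W W' : InvAffine ρ} (h : W ≤ W') (f : Γ(P, W'.1))
    (hf : P.basicOpen f ≤ W.1) :
    (∀ a, res h a = 0 → ∃ n : ℕ, f ^ n * a = 0) ∧
      ∀ a', ∃ (n : ℕ) (a : Γ(P, W'.1)), res h a = res h f ^ n * a' := by
  have hloc := W'.2.isLocalization_basicOpen f
  have hloc' := W.2.isLocalization_basicOpen (res h f)
  have hbo : P.basicOpen (res h f) = P.basicOpen f := by
    rw [res, Scheme.basicOpen_res]
    exact inf_eq_right.2 hf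
  have hle : P.basicOpen (res h f) ≤ P.basicOpen f := hbo.le
  have hcomp : ∀ a, algebraMap Γ(P, W.1) Γ(P, P.basicOpen (res h f)) (res h a) =
      P.presheaf.map (homOfLE hle).op (algebraMap Γ(P, W'.1) Γ(P, P.basicOpen f) a) := by
    intro a
    have : res h ≫ P.presheaf.map (homOfLE (P.basicOpen_le (res h f))).op =
        P.presheaf.map (homOfLE (P.basicOpen_le f)).op ≫ P.presheaf.map (homOfLE hle).op := by
      exact (P.presheaf.map_comp _ _).symm.trans
        (P.presheaf.map_comp (homOfLE (P.basicOpen_le f)).op (homOfLE hle).op)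
    exact congr($this a)
  have hiso : IsIso (P.presheaf.map (homOfLE hle).op) := by
    have : IsIso (homOfLE hle) := ⟨homOfLE hbo.ge, rfl, rfl⟩
    infer_instance
  have hbij : Function.Bijective (P.presheaf.map (homOfLE hle).op) :=
    ConcreteCategory.bijective_of_isIso _
  constructor
  · intro a ha
    have h1 : algebraMap Γ(P, W'.1) Γ(P, P.basicOpen f) a =
        algebraMap Γ(P, W'.1) Γ(P, P.basicOpen f) 0 := by
      apply hbij.1
      simp only [← hcomp, ha, map_zero]
    obtain ⟨n, hn⟩ := IsLocalization.Away.exists_of_eq f h1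
    exact ⟨n, by rw [hn, mul_zero]⟩
  · intro a'
    obtain ⟨b, hb⟩ := hbij.2 (algebraMap Γ(P, W.1) Γ(P, P.basicOpen (res h f)) a')
    obtain ⟨n, a, ha⟩ := IsLocalization.Away.surj f b
    have h1 : algebraMap Γ(P, W.1) Γ(P, P.basicOpen (res h f)) (res h f ^ n * a') =
        algebraMap Γ(P, W.1) Γ(P, P.basicOpen (res h f)) (res h a) := by
      rw [hcomp, ← ha, map_mul, map_mul, hb, map_pow, map_pow, hcomp, mul_comm]
    obtain ⟨m, hm⟩ := IsLocalization.Away.exists_of_eq (res h f) h1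
    refine ⟨m + n, f ^ m * a, ?_⟩
    rw [map_mul, map_pow, ← hm, pow_add, mul_assoc]

variable [Group G] (hρ : IsAction ρ)

lemma map_quot_apply {W W' : InvAffine ρ} (h : W ≤ W') (z : Spec Γ(P, W.1)) :
    (quotientFunctor ρ hρ).map (homOfLE h) (W.quot hρ z) = W'.quot hρ (Spec.map (res h) z) := by
  rw [← Scheme.Hom.comp_apply, ← Scheme.Hom.comp_apply, specMap_res_quot]

variable [Finite G]

lemma quotientFunctor_map_injective {W W' : InvAffine ρ} (h : W ≤ W') :
    Function.Injective ((quotientFunctor ρ hρ).map (homOfLE h)) := by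
  intro y y' hy
  obtain ⟨z, rfl⟩ := W.quot_surjective hρ y
  obtain ⟨z', rfl⟩ := W.quot_surjective hρ y'
  rw [map_quot_apply, map_quot_apply] at hy
  obtain ⟨g, hg⟩ := W'.exists_emb_eq_of_quot_eq hρ hy
  rw [emb_specMap_res, emb_specMap_res] at hg
  exact W.quot_eq_of_emb_eq hρ hg

/-- Around each point an invariant `f` has its basic open inside `W`; inverting it identifies the
two rings of invariants. The map is thus a local isomorphism, and it is injective because fibres are
orbits. -/
lemma isOpenImmersion_quotientFunctor_map {W W' : InvAffine ρ} (h : W ≤ W') :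
    IsOpenImmersion ((quotientFunctor ρ hρ).map (homOfLE h)) := by
  have hl : IsLocalIso (Spec.map (invRes hρ h)) := by
    refine ⟨fun y => ?_⟩
    obtain ⟨z, rfl⟩ := W.quot_surjective hρ y
    obtain ⟨f, hxf, hf⟩ := W'.exists_basicOpen_le hρ W.3 (h (W.emb_mem z)) (W.emb_mem z)
    obtain ⟨h1, h2⟩ := res_localization h f.1 hf
    obtain ⟨h3, h4⟩ := (W'.isInvariants hρ).localization_lift (W.isInvariants hρ)
      (r := (res h).hom) (s := (invRes hρ h).hom) rfl (res_sectionAction hρ h) f h1 h2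
    have himm := isOpenImmersion_specMap_localization (invRes hρ h) f h3 h4
    let j := Spec.map (CommRingCat.ofHom (algebraMap (CommRingCat.of (W.invRing hρ))
      (Localization.Away (invRes hρ h f))))
    have hj : IsOpenImmersion j := IsOpenImmersion.of_isLocalization (invRes hρ h f)
    refine ⟨j.opensRange, ?_, ?_⟩
    · have hr := Scheme.Hom.opensRange_localizationAway
        (R := CommRingCat.of (W.invRing hρ)) (invRes hρ h f)
      have hz : W.quot hρ z ∈ PrimeSpectrum.basicOpen (invRes hρ h f) := by
        have h5 : z ∈ PrimeSpectrum.basicOpen (res h f.1) := by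
          rw [← W.2.fromSpec_preimage_basicOpen, res, Scheme.basicOpen_res]
          exact ⟨W.emb_mem z, hxf⟩
        exact h5
      change W.quot hρ z ∈ j.opensRange
      rw [show j.opensRange = PrimeSpectrum.basicOpen (invRes hρ h f) from hr]
      exact hz
    · have h6 : j.opensRange.ι ≫ Spec.map (invRes hρ h) =
          j.isoOpensRange.inv ≫ (j ≫ Spec.map (invRes hρ h)) := by
        rw [← Category.assoc, Scheme.Hom.isoOpensRange_inv_comp]
      rw [h6]
      infer_instance
  exact isOpenImmersion_of_isLocalIso (Spec.map (invRes hρ h)) (quotientFunctor_map_injective hρ h)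

instance {W W' : InvAffine ρ} (f : W ⟶ W') : IsOpenImmersion ((quotientFunctor ρ hρ).map f) :=
  isOpenImmersion_quotientFunctor_map hρ (leOfHom f)

/-- Points with the same image differ by a group element. As `W₁` is invariant, the point over `y₂`
lies in both opens, and a smaller invariant affine open around it suffices. -/
lemma exists_quotientFunctor_map_eq {W₁ W₂ W : InvAffine ρ} (h₁ : W₁ ≤ W) (h₂ : W₂ ≤ W)
    (y₁ : (quotientFunctor ρ hρ).obj W₁) (y₂ : (quotientFunctor ρ hρ).obj W₂)
    (h : (quotientFunctor ρ hρ).map (homOfLE h₁) y₁ =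
      (quotientFunctor ρ hρ).map (homOfLE h₂) y₂) :
    ∃ (W₀ : InvAffine ρ) (k₁ : W₀ ⟶ W₁) (k₂ : W₀ ⟶ W₂) (y : (quotientFunctor ρ hρ).obj W₀),
      (quotientFunctor ρ hρ).map k₁ y = y₁ ∧ (quotientFunctor ρ hρ).map k₂ y = y₂ := by
  obtain ⟨z₁, rfl⟩ := W₁.quot_surjective hρ y₁
  obtain ⟨z₂, rfl⟩ := W₂.quot_surjective hρ y₂
  rw [map_quot_apply, map_quot_apply] at h
  obtain ⟨g, hg⟩ := W.exists_emb_eq_of_quot_eq hρ h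
  rw [emb_specMap_res, emb_specMap_res] at hg
  have hx : W₂.emb z₂ ∈ W₁.1 := by
    rw [hg]
    exact W₁.3 g (W₁.emb_mem z₁)
  obtain ⟨W₀, k₁, k₂, hx₀⟩ := exists_le_le hρ W₁ W₂ hx (W₂.emb_mem z₂)
  obtain ⟨z₀, hz₀⟩ := W₀.exists_emb_eq hx₀
  refine ⟨W₀, homOfLE k₁, homOfLE k₂, W₀.quot hρ z₀, ?_, ?_⟩
  · rw [map_quot_apply]
    refine (W₁.quot_eq_of_emb_eq hρ (g := g) ?_).symm
    rw [emb_specMap_res, hz₀, hg]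
  · rw [map_quot_apply]
    congr 1
    apply W₂.emb_injective
    rw [emb_specMap_res, hz₀]

instance : (quotientFunctor ρ hρ ⋙ Scheme.forget).IsLocallyDirected where
  cond {_ _ _} f₁ f₂ y₁ y₂ h :=
    exists_quotientFunctor_map_eq hρ (leOfHom f₁) (leOfHom f₂) y₁ y₂ h

end InvAffine

end Gluing

/-! ### Checking the conditions on sections of a quotient on a basis -/

section Basis

variable {P Y : Scheme.{u}} (π : P ⟶ Y) {ι : Type*} {V : ι → Y.Opens}

lemma app_injective_of_basis (hV : ∀ (U : Y.Opens), ∀ y ∈ U, ∃ i, y ∈ V i ∧ V i ≤ U)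
    (hinj : ∀ i, Function.Injective (π.app (V i))) (U : Y.Opens) :
    Function.Injective (π.app U) := by
  intro s t hst
  refine TopCat.Sheaf.eq_of_locally_eq' Y.sheaf (fun i : {i // V i ≤ U} => V i.1) U
    (fun i => homOfLE i.2) ?_ s t ?_
  · intro y hy
    obtain ⟨i, hyi, hi⟩ := hV U y hy
    exact TopologicalSpace.Opens.mem_iSup.2 ⟨⟨i, hi⟩, hyi⟩
  · rintro ⟨i, hi⟩
    apply hinj i
    have hn := π.naturality (homOfLE hi).op
    have h1 := congr($hn s)
    have h2 := congr($hn t)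
    rw [CommRingCat.comp_apply, CommRingCat.comp_apply] at h1 h2
    exact h1.trans ((congrArg _ hst).trans h2.symm)

lemma exists_app_eq_of_basis (hV : ∀ (U : Y.Opens), ∀ y ∈ U, ∃ i, y ∈ V i ∧ V i ≤ U)
    (hinj : ∀ i, Function.Injective (π.app (V i))) (U : Y.Opens) (s : Γ(P, π ⁻¹ᵁ U))
    (hs : ∀ i (h : V i ≤ U), ∃ t : Γ(Y, V i),
      π.app (V i) t = P.presheaf.map (homOfLE (π.preimage_mono h)).op s) :
    ∃ t, π.app U t = s := by
  choose t ht using hs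
  have hcov : U ≤ ⨆ i : {i // V i ≤ U}, V i.1 := by
    intro y hy
    obtain ⟨i, hyi, hi⟩ := hV U y hy
    exact TopologicalSpace.Opens.mem_iSup.2 ⟨⟨i, hi⟩, hyi⟩
  have hcomp : TopCat.Presheaf.IsCompatible Y.presheaf (fun i : {i // V i ≤ U} => V i.1)
      fun i => t i.1 i.2 := by
    intro i j
    -- Both restrictions to the overlap map to the restriction of `s`, so injectivity yields
    -- compatibility.
    apply app_injective_of_basis π hV hinj
    have key : ∀ (k : {i // V i ≤ U}) (hk : V i.1 ⊓ V j.1 ≤ V k.1),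
        π.app (V i.1 ⊓ V j.1) (Y.presheaf.map (homOfLE hk).op (t k.1 k.2)) =
          P.presheaf.map (homOfLE (π.preimage_mono (hk.trans k.2))).op s := by
      intro k hk
      have h1 := congr($(π.naturality (homOfLE hk).op) (t k.1 k.2))
      rw [CommRingCat.comp_apply, CommRingCat.comp_apply, ht] at h1
      refine h1.trans ?_
      rw [← CommRingCat.comp_apply]
      exact congr($((P.presheaf.map_comp _ _).symm) s)
    exact (key i inf_le_left).trans (key j inf_le_right).symm
  obtain ⟨(r : Γ(Y, U)), hr, -⟩ := TopCat.Sheaf.existsUnique_gluing' Y.sheaf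
    (fun i : {i // V i ≤ U} => V i.1) U (fun i => homOfLE i.2) hcov (fun i => t i.1 i.2) hcomp
  refine ⟨r, ?_⟩
  refine TopCat.Sheaf.eq_of_locally_eq' P.sheaf (fun i : {i // V i ≤ U} => π ⁻¹ᵁ V i.1)
    (π ⁻¹ᵁ U) (fun i => homOfLE (π.preimage_mono i.2)) ?_ _ s ?_
  · intro x hx
    obtain ⟨i, hyi, hi⟩ := hV U (π x) hx
    exact TopologicalSpace.Opens.mem_iSup.2 ⟨⟨i, hi⟩, hyi⟩
  · intro i
    have h1 := congr($(π.naturality (homOfLE i.2).op) r)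
    rw [CommRingCat.comp_apply, CommRingCat.comp_apply] at h1
    refine h1.symm.trans ((congrArg _ (hr i)).trans (ht i.1 i.2))

end Basis

/-! ### The glued quotient -/

section Gluing

variable {P : Scheme.{u}} {G : Type*} {ρ : G → (P ⟶ P)}

namespace InvAffine

/-- Morphisms from `P` are determined by their restrictions to invariant affine open subsets. -/
lemma hom_ext_emb (hcov : ∀ x : P, ∃ W : InvAffine ρ, x ∈ W.1) {Y : Scheme.{u}} {f f' : P ⟶ Y}
    (h : ∀ W : InvAffine ρ, W.emb ≫ f = W.emb ≫ f') : f = f' := by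
  refine Scheme.hom_ext_of_forall _ _ fun x => ?_
  obtain ⟨W, hW⟩ := hcov x
  refine ⟨W.1, hW, ?_⟩
  rw [← W.2.toSpecΓ_fromSpec, Category.assoc, Category.assoc]
  exact congrArg _ (h W)

/-- The cover by the invariant affine open subsets. -/
noncomputable def openCover (hcov : ∀ x : P, ∃ W : InvAffine ρ, x ∈ W.1) : P.OpenCover where
  I₀ := InvAffine ρ
  X W := Spec Γ(P, W.1)
  f W := W.emb
  mem₀ := by
    rw [Scheme.presieve₀_mem_precoverage_iff]
    refine ⟨fun x => ?_, inferInstance⟩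
    obtain ⟨W, hW⟩ := hcov x
    exact ⟨W, W.exists_emb_eq hW⟩

variable [Group G] [Finite G]

/-- The overlap is covered by smaller invariant affine opens `W₀`, on which both sides restrict to
`g W₀`. -/
lemma fst_comp_eq_snd_comp (hρ : IsAction ρ) {Y : Scheme.{u}} (g : ∀ W : InvAffine ρ, Spec Γ(P, W.1) ⟶ Y)
    (hg : ∀ {W W' : InvAffine ρ} (h : W ≤ W'), Spec.map (res h) ≫ g W' = g W) (W W' : InvAffine ρ) :
    pullback.fst W.emb W'.emb ≫ g W = pullback.snd W.emb W'.emb ≫ g W' := by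
  refine Scheme.hom_ext_of_forall _ _ fun x => ?_
  have hx : W.emb (pullback.fst W.emb W'.emb x) = W'.emb (pullback.snd W.emb W'.emb x) := by
    rw [← Scheme.Hom.comp_apply, ← Scheme.Hom.comp_apply, pullback.condition]
  obtain ⟨W₀, h, h', hx₀⟩ := exists_le_le hρ W W' (W.emb_mem (pullback.fst W.emb W'.emb x))
    (hx ▸ W'.emb_mem _)
  obtain ⟨z, hz⟩ := W₀.exists_emb_eq hx₀
  let α : Spec Γ(P, W₀.1) ⟶ pullback W.emb W'.emb :=
    pullback.lift (Spec.map (res h)) (Spec.map (res h'))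
      (by rw [specMap_res_emb, specMap_res_emb])
  have hα : α ≫ pullback.fst W.emb W'.emb ≫ W.emb = W₀.emb := by
    rw [← Category.assoc, pullback.lift_fst, specMap_res_emb]
  have hopen : IsOpenImmersion α := by
    have : IsOpenImmersion (α ≫ pullback.fst W.emb W'.emb ≫ W.emb) := by
      rw [hα]
      infer_instance
    exact IsOpenImmersion.of_comp α (pullback.fst W.emb W'.emb ≫ W.emb)
  refine ⟨α.opensRange, ⟨z, ?_⟩, ?_⟩
  · apply (pullback.fst W.emb W'.emb ≫ W.emb).isOpenEmbedding.injective
    rw [← Scheme.Hom.comp_apply, hα, hz, Scheme.Hom.comp_apply]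
  · rw [← cancel_epi α.isoOpensRange.hom, Scheme.Hom.isoOpensRange_hom_ι_assoc,
      Scheme.Hom.isoOpensRange_hom_ι_assoc, ← Category.assoc, ← Category.assoc,
      pullback.lift_fst, pullback.lift_snd, hg, hg]

lemma exists_glue (hρ : IsAction ρ) (hcov : ∀ x : P, ∃ W : InvAffine ρ, x ∈ W.1) {Y : Scheme.{u}}
    (g : ∀ W : InvAffine ρ, Spec Γ(P, W.1) ⟶ Y)
    (hg : ∀ {W W' : InvAffine ρ} (h : W ≤ W'), Spec.map (res h) ≫ g W' = g W) :
    ∃ π : P ⟶ Y, ∀ W : InvAffine ρ, W.emb ≫ π = g W :=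
  ⟨(openCover hcov).glueMorphisms g (fst_comp_eq_snd_comp hρ g hg),
    fun W => (openCover hcov).ι_glueMorphisms g (fst_comp_eq_snd_comp hρ g hg) W⟩

variable (hρ : IsAction ρ)

/-- The glued quotient. -/
noncomputable abbrev glued : Scheme.{u} := colimit (quotientFunctor ρ hρ)

/-- The inclusion of a local quotient into the glued quotient. -/
noncomputable abbrev gluedι (W : InvAffine ρ) :
    Spec (CommRingCat.of (W.invRing hρ)) ⟶ glued hρ :=
  colimit.ι (quotientFunctor ρ hρ) W

instance (W : InvAffine ρ) : IsOpenImmersion (gluedι hρ W) :=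
  inferInstanceAs (IsOpenImmersion (colimit.ι (quotientFunctor ρ hρ) W))

variable {hρ} in
/-- The morphism `π` restricts to the local quotient maps. -/
abbrev IsGluedQuotient (π : P ⟶ glued hρ) : Prop :=
  ∀ W : InvAffine ρ, W.emb ≫ π = Spec.map (W.incl hρ) ≫ gluedι hρ W

lemma exists_gluedQuotient (hcov : ∀ x : P, ∃ W : InvAffine ρ, x ∈ W.1) :
    ∃ π : P ⟶ glued hρ, IsGluedQuotient π := by
  refine exists_glue hρ hcov (fun W => Spec.map (W.incl hρ) ≫ gluedι hρ W) ?_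
  intro W W' h
  have h1 := specMap_res_quot hρ h
  rw [← Category.assoc]
  refine (congrArg (· ≫ gluedι hρ W') h1).trans ?_
  refine (Category.assoc _ _ _).trans ?_
  exact congrArg _ (colimit.w (quotientFunctor ρ hρ) (homOfLE h))

variable {hρ} {π : P ⟶ glued hρ}

lemma apply_emb (hπ : IsGluedQuotient π) (W : InvAffine ρ) (z : Spec Γ(P, W.1)) :
    π (W.emb z) = gluedι hρ W (W.quot hρ z) := by
  rw [← Scheme.Hom.comp_apply, hπ]
  rfl

/-- Charts are identified only through smaller charts. So a point mapping into the chart of `W` is a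
translate of a point of some `W₀ ≤ W`, and `W₀` is invariant. -/
lemma preimage_opensRange (hπ : IsGluedQuotient π) (hcov : ∀ x : P, ∃ W : InvAffine ρ, x ∈ W.1) (W : InvAffine ρ) :
    π ⁻¹ᵁ (gluedι hρ W).opensRange = W.1 := by
  ext x
  constructor
  · rintro ⟨y, hy⟩
    obtain ⟨W', hW'⟩ := hcov x
    obtain ⟨z', rfl⟩ := W'.exists_emb_eq hW'
    rw [apply_emb hπ] at hy
    obtain ⟨W₀, f, f', y₀, h, h'⟩ :=
      (Scheme.IsLocallyDirected.ι_eq_ι_iff (quotientFunctor ρ hρ)).1 hy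
    obtain ⟨z₀, rfl⟩ := W₀.quot_surjective hρ y₀
    have h'' := (map_quot_apply hρ (leOfHom f') z₀).symm.trans h'
    obtain ⟨g, hg⟩ := W'.exists_emb_eq_of_quot_eq hρ h''
    rw [emb_specMap_res] at hg
    change W'.emb z' ∈ W.1
    rw [hg]
    exact leOfHom f (W₀.3 g (W₀.emb_mem z₀))
  · intro hx
    obtain ⟨z, rfl⟩ := W.exists_emb_eq hx
    exact ⟨W.quot hρ z, (apply_emb hπ W z).symm⟩

lemma act_comp (hπ : IsGluedQuotient π) (hcov : ∀ x : P, ∃ W : InvAffine ρ, x ∈ W.1) (g : G) : ρ g ≫ π = π := by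
  refine hom_ext_emb hcov fun W => ?_
  rw [← Category.assoc, ← specMap_act_emb, Category.assoc, hπ, ← Category.assoc]
  exact congrArg (· ≫ gluedι hρ W) (specMap_act_quot hρ W g)

lemma exists_opensRange_le (hπ : IsGluedQuotient π) (hcov : ∀ x : P, ∃ W : InvAffine ρ, x ∈ W.1) (U : (glued hρ).Opens)
    (y : glued hρ) (hy : y ∈ U) :
    ∃ W : InvAffine ρ, y ∈ (gluedι hρ W).opensRange ∧ (gluedι hρ W).opensRange ≤ U := by
  obtain ⟨W, y₀, rfl⟩ := Scheme.IsLocallyDirected.ι_jointly_surjective (quotientFunctor ρ hρ) y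
  obtain ⟨z, rfl⟩ := W.quot_surjective hρ y₀
  have hU : ∀ g, π ⁻¹ᵁ U ≤ ρ g ⁻¹ᵁ (π ⁻¹ᵁ U) := fun g => by
    rw [← Scheme.Hom.comp_preimage, act_comp hπ hcov]
  have hz : π (W.emb z) = colimit.ι (quotientFunctor ρ hρ) W (W.quot hρ z) := apply_emb hπ W z
  rw [← hz] at hy ⊢
  obtain ⟨f, hxf, hf⟩ := W.exists_basicOpen_le hρ hU (W.emb_mem z) hy
  refine ⟨W.basicOpen hρ f, ?_, ?_⟩
  · have : W.emb z ∈ π ⁻¹ᵁ (gluedι hρ (W.basicOpen hρ f)).opensRange := by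
      rw [preimage_opensRange hπ hcov]
      exact hxf
    exact this
  · rintro _ ⟨y₁, rfl⟩
    obtain ⟨z₁, rfl⟩ := (W.basicOpen hρ f).quot_surjective hρ y₁
    rw [← apply_emb hπ]
    exact hf ((W.basicOpen hρ f).emb_mem z₁)

/-- On the chart of `W`, `π` is Spec of the inclusion of the invariants. The open `O` is kept
separate because the preimage of the chart equals `W.1` only propositionally. -/
lemma appLE_opensRange (hπ : IsGluedQuotient π) (W : InvAffine ρ) {O : P.Opens} (hO : O = W.1)
    (h : O ≤ π ⁻¹ᵁ (gluedι hρ W).opensRange) :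
    Function.Injective (π.appLE (gluedι hρ W).opensRange O h) ∧
      ∀ s : Γ(P, O), (∀ g (hg : O ≤ ρ g ⁻¹ᵁ O), (ρ g).appLE O O hg s = s) →
        ∃ t, π.appLE (gluedι hρ W).opensRange O h t = s := by
  subst hO
  have hV : IsAffineOpen (gluedι hρ W).opensRange := isAffineOpen_opensRange _
  let θ := IsOpenImmersion.isoOfRangeEq (gluedι hρ W) hV.fromSpec (by rw [hV.range_fromSpec]; rfl)
  have hθ : θ.hom ≫ hV.fromSpec = gluedι hρ W := IsOpenImmersion.isoOfRangeEq_hom_fac _ _ _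
  let e := Spec.preimage θ.hom
  have he : Spec.map e = θ.hom := Spec.map_preimage _
  have hiso : IsIso e := by
    have h1 : IsIso (Scheme.Spec.map e.op) := by
      change IsIso (Spec.map e)
      rw [he]
      infer_instance
    have h2 : IsIso e.op := isIso_of_reflects_iso e.op Scheme.Spec
    exact (isIso_op_iff e).1 h2
  have key : π.appLE (gluedι hρ W).opensRange W.1 h = e ≫ W.incl hρ := by
    apply specMap_fromSpec_injective hV
    rw [hV.SpecMap_appLE_fromSpec π W.2 h, Spec.map_comp, Category.assoc, he, hθ]
    exact hπ W
  have hbij : Function.Bijective e := ConcreteCategory.bijective_of_isIso e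
  rw [key]
  constructor
  · intro a b hab
    exact hbij.1 (Subtype.val_injective hab)
  · intro s hs
    obtain ⟨t, ht⟩ := hbij.2 (⟨s, fun g => hs g (W.3 g)⟩ : W.invRing hρ)
    exact ⟨t, congrArg Subtype.val ht⟩

/-- The glued quotient maps to every affine scheme to which `P` maps invariantly. -/
lemma exists_gluedDesc {S : Scheme.{u}} [IsAffine S] (p : P ⟶ S) (hp : ∀ g, ρ g ≫ p = p) :
    ∃ c : glued hρ ⟶ S, ∀ W : InvAffine ρ,
      Spec.map (W.incl hρ) ≫ gluedι hρ W ≫ c = W.emb ≫ p := by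
  have htop := isAffineOpen_top S
  have hle : ∀ W : InvAffine ρ, W.1 ≤ p ⁻¹ᵁ ⊤ := fun W => le_top
  have hinv : ∀ (W : InvAffine ρ) (b : Γ(S, ⊤)), p.appLE ⊤ W.1 (hle W) b ∈ W.invRing hρ := by
    intro W b g
    have h : ∀ (f : P ⟶ S), f = p → f.appLE ⊤ W.1 (fun _ _ => trivial) = p.appLE ⊤ W.1 (hle W) := by
      rintro f rfl
      rfl
    have h2 := h _ (hp g)
    rw [← Scheme.Hom.appLE_comp_appLE _ _ _ W.1 _ (hle W) (W.3 g)] at h2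
    exact congr($h2 b)
  let d : ∀ W : InvAffine ρ, Γ(S, ⊤) ⟶ CommRingCat.of (W.invRing hρ) := fun W =>
    CommRingCat.ofHom ((p.appLE ⊤ W.1 (hle W)).hom.codRestrict _ (hinv W))
  have hd : ∀ W, d W ≫ W.incl hρ = p.appLE ⊤ W.1 (hle W) := fun W => rfl
  have hdres : ∀ {W W' : InvAffine ρ} (h : W ≤ W'), d W' ≫ invRes hρ h = d W := by
    intro W W' h
    rw [← cancel_mono (W.incl hρ), Category.assoc, invRes_incl, ← Category.assoc, hd, hd, res,
      Scheme.Hom.appLE_map]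
  let t : Cocone (quotientFunctor ρ hρ) :=
    { pt := S
      ι := { app := fun W => Spec.map (d W) ≫ htop.fromSpec
             naturality := fun W W' f => by
              change Spec.map (invRes hρ (leOfHom f)) ≫ Spec.map (d W') ≫ htop.fromSpec =
                (Spec.map (d W) ≫ htop.fromSpec) ≫ 𝟙 S
              rw [← Category.assoc, ← Spec.map_comp, hdres, Category.comp_id] } }
  refine ⟨colimit.desc _ t, fun W => ?_⟩
  have h1 : gluedι hρ W ≫ colimit.desc _ t = Spec.map (d W) ≫ htop.fromSpec :=
    colimit.ι_desc t W
  rw [h1, ← Category.assoc, ← Spec.map_comp, hd]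
  exact htop.SpecMap_appLE_fromSpec p W.2 (hle W)

end InvAffine

end Gluing

/-- A finite group acting on a scheme over an affine base which is covered by invariant affine
open subsets admits a quotient. -/
theorem exists_isQuotient {S : Scheme.{u}} [IsAffine S] {G : Type*} [Group G] [Finite G]
    {P : Over S} {act : G → (P ⟶ P)} (hact : IsAction fun g => (act g).left)
    (hcov : ∀ x : P.left, ∃ W : InvAffine fun g => (act g).left, x ∈ W.1) :
    ∃ (Y : Over S) (π : P ⟶ Y), IsQuotient act π := by
  obtain ⟨π, hπ⟩ := InvAffine.exists_gluedQuotient hact hcov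
  obtain ⟨c, hc⟩ := InvAffine.exists_gluedDesc (hρ := hact) P.hom fun g => Over.w (act g)
  have hw : π ≫ c = P.hom := InvAffine.hom_ext_emb hcov fun W => by
    rw [← Category.assoc, hπ, Category.assoc, hc]
  have hbasis := InvAffine.exists_opensRange_le hπ hcov
  have hpre := InvAffine.preimage_opensRange hπ hcov
  have hinj : ∀ W, Function.Injective (π.app (InvAffine.gluedι hact W).opensRange) := by
    intro W
    rw [← Scheme.Hom.appLE_eq_app]
    exact (InvAffine.appLE_opensRange hπ W (hpre W) le_rfl).1
  have hex : ∀ (U : (InvAffine.glued hact).Opens) (s : Γ(P.left, π ⁻¹ᵁ U)),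
      (∀ (g : G) (h : π ⁻¹ᵁ U ≤ (act g).left ⁻¹ᵁ (π ⁻¹ᵁ U)),
        (act g).left.appLE (π ⁻¹ᵁ U) (π ⁻¹ᵁ U) h s = s) → ∃ t, π.app U t = s := by
    intro U s hs
    refine exists_app_eq_of_basis π hbasis hinj U s fun W h => ?_
    obtain ⟨t, ht⟩ := (InvAffine.appLE_opensRange hπ W (hpre W) le_rfl).2
      (P.left.presheaf.map (homOfLE (π.preimage_mono h)).op s) (by
        intro g hg
        have hgU : π ⁻¹ᵁ U ≤ (act g).left ⁻¹ᵁ (π ⁻¹ᵁ U) := by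
          rw [← Scheme.Hom.comp_preimage, InvAffine.act_comp hπ hcov]
        have h1 : P.left.presheaf.map (homOfLE (π.preimage_mono h)).op ≫
              (act g).left.appLE _ _ hg =
            (act g).left.appLE _ _ hgU ≫
              P.left.presheaf.map (homOfLE (π.preimage_mono h)).op := by
          rw [Scheme.Hom.appLE_map, Scheme.Hom.map_appLE]
        have h2 := congr($h1 s)
        rw [CommRingCat.comp_apply, CommRingCat.comp_apply] at h2
        exact h2.trans (congrArg _ (hs g hgU)))
    rw [Scheme.Hom.appLE_eq_app] at ht
    exact ⟨t, ht⟩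
  refine ⟨Over.mk c, Over.homMk π hw, ?_, ?_, ?_, ?_⟩
  · intro g
    ext1
    exact InvAffine.act_comp hπ hcov g
  · refine isAffineHom_of_forall_exists_isAffineOpen π fun y => ?_
    obtain ⟨W, hy, -⟩ := hbasis ⊤ y trivial
    refine ⟨_, hy, isAffineOpen_opensRange _, ?_⟩
    have : IsAffineOpen (π ⁻¹ᵁ (InvAffine.gluedι hact W).opensRange) := by
      rw [hpre W]
      exact W.2
    exact this
  · exact app_injective_of_basis π hbasis hinj
  · exact hex

/-! ### Affine opens of the powers and existence of symmetric products -/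

section AffineProducts

/-- With `toSpecΓ_cancel`, this is the universal property of the affinization of `T`. -/
lemma exists_toSpecΓ_comp_eq {T Z : Scheme.{u}} [IsAffine Z] (h : T ⟶ Z) :
    ∃ h' : Spec Γ(T, ⊤) ⟶ Z, T.toSpecΓ ≫ h' = h := by
  refine ⟨Spec.map h.appTop ≫ Z.isoSpec.inv, ?_⟩
  rw [← Category.assoc, ← Scheme.toSpecΓ_naturality, Category.assoc,
    Scheme.toSpecΓ_isoSpec_inv, Category.comp_id]

lemma toSpecΓ_cancel {T Z : Scheme.{u}} [IsAffine Z] {f g : Spec Γ(T, ⊤) ⟶ Z}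
    (h : T.toSpecΓ ≫ f = T.toSpecΓ ≫ g) : f = g := by
  apply ext_of_isAffine
  have h1 : (T.toSpecΓ ≫ f).appTop = (T.toSpecΓ ≫ g).appTop := by rw [h]
  have hiso : IsIso T.toSpecΓ.appTop := by
    rw [Scheme.toSpecΓ_appTop]
    infer_instance
  rw [Scheme.Hom.comp_appTop, Scheme.Hom.comp_appTop] at h1
  exact (cancel_mono _).1 h1

variable {S : Scheme.{u}} (X : Over S) (n : ℕ)

/-- The points of the `n`-fold product all of whose coordinates lie in `U`. -/
noncomputable def powerOpen (U : X.left.Opens) : (power X n).left.Opens where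
  carrier := ⋂ i : Fin n, (Pi.π (fun _ : Fin n => X) i).left ⁻¹ᵁ U
  is_open' := isOpen_iInter_of_finite fun i =>
    ((Pi.π (fun _ : Fin n => X) i).left ⁻¹ᵁ U).isOpen

variable {X n}

lemma mem_powerOpen {U : X.left.Opens} {x : (power X n).left} :
    x ∈ powerOpen X n U ↔ ∀ i, (Pi.π (fun _ : Fin n => X) i).left x ∈ U :=
  Set.mem_iInter

/-- The coordinates `T ⟶ U` and the structure map `T ⟶ S` have affine targets, so they factor
through the affinization of `T`. The universal property of the product then yields a map back to
`T`, inverse to `T.toSpecΓ`. -/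
lemma isAffineOpen_powerOpen [IsAffine S] {U : X.left.Opens} (hU : IsAffineOpen U) :
    IsAffineOpen (powerOpen X n U) := by
  have hUaff : IsAffine U := hU
  let W := powerOpen X n U
  let T : Scheme.{u} := W
  let s : T ⟶ S := W.ι ≫ (power X n).hom
  let v : ∀ _ : Fin n, T ⟶ X.left := fun i => W.ι ≫ (Pi.π (fun _ : Fin n => X) i).left
  have hv : ∀ i (x : T), v i x ∈ U := fun i x => by
    have h1 : W.ι x ∈ W := x.2
    have := mem_powerOpen.1 h1 i
    rwa [← Scheme.Hom.comp_apply] at this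
  have hvr : ∀ i, Set.range (v i) ⊆ Set.range U.ι := by
    rintro i _ ⟨x, rfl⟩
    rw [Scheme.Opens.range_ι]
    exact hv i x
  choose u' hu' using fun i => exists_toSpecΓ_comp_eq (IsOpenImmersion.lift U.ι (v i) (hvr i))
  obtain ⟨s', hs'⟩ := exists_toSpecΓ_comp_eq s
  have hus : ∀ i, (u' i ≫ U.ι) ≫ X.hom = s' := by
    intro i
    apply toSpecΓ_cancel
    rw [hs', ← Category.assoc, ← Category.assoc, hu', IsOpenImmersion.lift_fac, Category.assoc,
      Over.w]
  let A : Over S := Over.mk s'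
  let a : ∀ _ : Fin n, A ⟶ X := fun i => Over.homMk (u' i ≫ U.ι) (hus i)
  let q : A ⟶ power X n := Pi.lift a
  have hqπ : ∀ i, q.left ≫ (Pi.π (fun _ : Fin n => X) i).left = u' i ≫ U.ι := by
    intro i
    rw [← Over.comp_left, Pi.lift_π]
    rfl
  have hq : Set.range q.left ⊆ Set.range W.ι := by
    rintro _ ⟨x, rfl⟩
    rw [Scheme.Opens.range_ι]
    refine mem_powerOpen.2 fun i => ?_
    rw [← Scheme.Hom.comp_apply, hqπ, Scheme.Hom.comp_apply]
    exact (u' i x).2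
  let r : Spec Γ(T, ⊤) ⟶ T := IsOpenImmersion.lift W.ι q.left hq
  have hr : r ≫ W.ι = q.left := IsOpenImmersion.lift_fac _ _ _
  have h1 : T.toSpecΓ ≫ r = 𝟙 T := by
    rw [← cancel_mono W.ι, Category.assoc, hr, Category.id_comp]
    let B : Over S := Over.mk s
    let b₁ : B ⟶ power X n := Over.homMk (T.toSpecΓ ≫ q.left) (by
      rw [Category.assoc, Over.w]
      exact hs')
    let b₂ : B ⟶ power X n := Over.homMk W.ι rfl
    have hb : b₁ = b₂ := by
      refine Pi.hom_ext _ _ fun i => ?_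
      refine Over.OverMorphism.ext ?_
      change (T.toSpecΓ ≫ q.left) ≫ (Pi.π (fun _ : Fin n => X) i).left = v i
      rw [Category.assoc, hqπ, ← Category.assoc, hu', IsOpenImmersion.lift_fac]
    exact congrArg (fun f => Over.Hom.left f) hb
  have h2 : r ≫ T.toSpecΓ = 𝟙 _ := by
    apply toSpecΓ_cancel
    rw [← Category.assoc, h1, Category.id_comp, Category.comp_id]
  have hiso : IsIso T.toSpecΓ := ⟨r, h1, h2⟩
  exact ⟨hiso⟩

lemma powerOpen_le_preimage (U : X.left.Opens) (σ : Equiv.Perm (Fin n)) :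
    powerOpen X n U ≤ (permute X n σ).left ⁻¹ᵁ powerOpen X n U := by
  intro x hx
  refine mem_powerOpen.2 fun i => ?_
  have h : (permute X n σ).left ≫ (Pi.π (fun _ : Fin n => X) i).left =
      (Pi.π (fun _ : Fin n => X) (σ i)).left := by
    rw [← Over.comp_left, permute, Pi.lift_π]
  rw [← Scheme.Hom.comp_apply, h]
  exact mem_powerOpen.1 hx (σ i)

variable (n) in
/-- Symmetric products exist if finite sets of points lie in affine open subsets. -/
lemma exists_isSymmetricProduct [IsAffine S] (hX : FiniteSetsInAffine X.left) :
    ∃ (Y : Over S) (π : power X n ⟶ Y), IsSymmetricProduct X n π := by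
  refine exists_isQuotient (isAction_permute X n) fun x => ?_
  obtain ⟨U, hU, hx⟩ := hX (Set.range fun i => (Pi.π (fun _ : Fin n => X) i).left x)
    (Set.finite_range _)
  exact ⟨⟨powerOpen X n U, isAffineOpen_powerOpen hU, powerOpen_le_preimage U⟩,
    mem_powerOpen.2 fun i => hx ⟨i, rfl⟩⟩

end AffineProducts

end SymZeta

theorem mainTheorem2 (k : Type u) [Field k] [Finite k]
    (X : Over (Spec (CommRingCat.of k))) (hX : SymZeta.IsVariety X) :
    (SymZeta.FiniteSetsInAffine X.left →
      ∀ n : ℕ, ∃ (Y : Over (Spec (CommRingCat.of k))) (π : SymZeta.power X n ⟶ Y),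
        SymZeta.IsSymmetricProduct X n π) ∧
    (∀ n : ℕ, 1 ≤ n → Finite (SymZeta.Points X (SymZeta.Ext k n))) ∧
    ∀ (Y : ℕ → Over (Spec (CommRingCat.of k))) (π : ∀ n, SymZeta.power X n ⟶ Y n),
      (∀ n, SymZeta.IsSymmetricProduct X n (π n)) →
        (∀ n, Finite (SymZeta.Points (Y n) k)) ∧
        PowerSeries.mk (fun n => (Nat.card (SymZeta.Points (Y n) k) : ℚ)) =
          SymZeta.hasseWeil X := by
  have hpts : ∀ n, Finite (SymZeta.Points X (SymZeta.Ext k n)) := fun n => by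
    have := hX.locallyOfFiniteType
    have := hX.quasiCompact
    have : Finite (SymZeta.Ext k n) := Module.finite_of_finite k
    exact SymZeta.finite_points X _
  exact ⟨fun h n => SymZeta.exists_isSymmetricProduct n h, fun n _ => hpts n,
    SymZeta.mk_card_points_eq_hasseWeil k X hpts⟩
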